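/- **Theorem 2.2 (Rigidity Theorem).** Let $\mu$ and $\nu$ be Borel measures on $\mathbb R$, let $\alpha\in\mathbb R$, and let all $L^2$-spaces be complex. Assume that the support of $\mu$ contains at least two distinct points and that $\int_{\mathbb R}(1+|t|)^{-1}\,d\mu(t)<\infty$. For compactly supported $C^1$ functions $f:\mathbb R\to\mathbb C$ put $$Vf(s)=f(s)-\alpha\int_{\mathbb R}\frac{f(s)-f(t)}{s-t}\,d\mu(t),$$ where the difference quotient is understood as $f'(s)$ for $t=s$. Assume that $V$ extends to a bounded operator $V:L^2(\mu)\to L^2(\nu)$ (so that $Vf$ is given by the formula $\nu$-a.e. for every compactly supported $C^1$ function $f$), and that $\operatorname{Ker}V=\{0\}$. Then there is a measurable function $h:\mathbb R\to\mathbb C$, with $h\ne0$ $\nu$-a.e. and $1/h\in L^\infty(\nu)$, such that $U:=M_hV$, $Uf=h\cdot Vf$, is a unitary operator from $L^2(\mu)$ onto $L^2(\nu)$; equivalently, $V$ is a unitary operator from $L^2(\mu)$ onto $L^2(|h|^2\,d\nu)$. Moreover, $U$ gives the spectral representation of the rank one perturbation $A_\alpha=M_t+\alpha(\,\cdot\,,\mathbf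 1)\mathbf 1$ in $L^2(\mu)$, that is, $UA_\alpha=M_sU$, domains included. Here $M_s$ is multiplication by the independent variable in $L^2(\nu)$ on the domain $\{g\in L^2(\nu): s\,g(s)\in L^2(\nu)\}$, and $A_\alpha$ is the form bounded perturbation $$(A_\alpha f)(t)=t f(t)+\alpha\int_{\mathbb R} f\,d\mu$$ on the domain of all $f\in L^2(\mu)$ with $\int(1+|t|)|f(t)|^2\,d\mu(t)<\infty$ for which the right-hand side belongs to $L^2(\mu)$ (the operator associated with the form $\int t\,|f|^2\,d\mu+\alpha\left|\int f\,d\mu\right|^2$ on $L^2((1+|t|)\,d\mu)$). -/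

import Mathlib

open MeasureTheory

noncomputable section

namespace RankOneRigidity

/-- The condition `∫ (1 + |t|)⁻¹ dμ(t) < ∞`, i.e. the constant function `1` belongs to
`H₋₁(M_t)`. -/
def FormBounded (μ : Measure ℝ) : Prop :=
  Integrable (fun t : ℝ => (1 + |t|)⁻¹) μ

/-- Continuous compactly supported functions belong to `L²(μ)`. -/
theorem FormBounded.memLp {μ : Measure ℝ} (hμ : FormBounded μ) {f : ℝ → ℂ}
    (hf : Continuous f) (hc : HasCompactSupport f) : MemLp f 2 μ := by
  have hfin : IsFiniteMeasureOnCompacts μ := by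
    refine ⟨fun K hK => ?_⟩
    obtain ⟨R, hR⟩ := hK.isBounded.exists_norm_le
    have hR0 : 0 < 1 + |R| := by positivity
    refine lt_of_le_of_lt (measure_mono ?_)
      (hμ.measure_norm_ge_lt_top (ε := (1 + |R|)⁻¹) (by positivity))
    intro t ht
    have h1 : |t| ≤ |R| := (hR t ht).trans (le_abs_self R)
    have h2 : (0 : ℝ) ≤ (1 + |t|)⁻¹ := by positivity
    change (1 + |R|)⁻¹ ≤ ‖(1 + |t|)⁻¹‖
    rw [Real.norm_of_nonneg h2]
    gcongr
  exact hf.memLp_of_hasCompactSupport hc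

/-- The function `s ↦ f(s) - α ∫ (f(s) - f(t)) / (s - t) dμ(t)`; on the diagonal `t = s` the
difference quotient is the derivative `f'(s)`, as built into `dslope`. -/
def reprV (μ : Measure ℝ) (α : ℝ) (f : ℝ → ℂ) (s : ℝ) : ℂ :=
  f s - (α : ℂ) * ∫ t, dslope f s t ∂μ

/-- The bounded operator `V : L²(μ) → L²(ν)` is an extension of the operator defined on compactly
supported `C¹` functions by the formula `reprV`. -/
def ExtendsReprV (μ ν : Measure ℝ) (hμ : FormBounded μ) (α : ℝ)
    (V : Lp ℂ 2 μ →L[ℂ] Lp ℂ 2 ν) : Prop :=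
  ∀ (f : ℝ → ℂ) (hf : ContDiff ℝ 1 f) (hc : HasCompactSupport f),
    V ((hμ.memLp hf.continuous hc).toLp f) =ᵐ[ν] reprV μ α f

theorem weight_zero (μ : Measure ℝ) (w : ℝ → ℂ) :
    (fun t => w t * (0 : Lp ℂ 2 μ) t) =ᵐ[μ] 0 := by
  filter_upwards [Lp.coeFn_zero ℂ 2 μ] with t ht
  rw [ht]
  exact mul_zero _

theorem weight_add {μ : Measure ℝ} (w : ℝ → ℂ) (f g : Lp ℂ 2 μ) :
    (fun t => w t * (f + g) t) =ᵐ[μ] (fun t => w t * f t) + fun t => w t * g t := by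
  filter_upwards [Lp.coeFn_add f g] with t ht
  rw [ht, Pi.add_apply, Pi.add_apply, mul_add]

theorem weight_smul {μ : Measure ℝ} (w : ℝ → ℂ) (c : ℂ) (f : Lp ℂ 2 μ) :
    (fun t => w t * (c • f) t) =ᵐ[μ] c • fun t => w t * f t := by
  filter_upwards [Lp.coeFn_smul c f] with t ht
  rw [ht, Pi.smul_apply, Pi.smul_apply, smul_eq_mul, smul_eq_mul, mul_left_comm]

/-- The subspace `{f ∈ L²(μ) : w f ∈ L²(μ)}` for a function `w`. -/
def weightDomain (μ : Measure ℝ) (w : ℝ → ℂ) : Submodule ℂ (Lp ℂ 2 μ) where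
  carrier := {f | MemLp (fun t => w t * f t) 2 μ}
  zero_mem' := (MemLp.zero (ε := ℂ)).ae_eq (weight_zero μ w).symm
  add_mem' := fun {f g} hf hg => (MemLp.add hf hg).ae_eq (weight_add w f g).symm
  smul_mem' := fun c f hf => (MemLp.const_smul hf c).ae_eq (weight_smul w c f).symm

theorem mem_weightDomain {μ : Measure ℝ} {w : ℝ → ℂ} {f : Lp ℂ 2 μ} :
    f ∈ weightDomain μ w ↔ MemLp (fun t => w t * f t) 2 μ := Iff.rfl

/-- The (in general unbounded) operator of multiplication by the independent variable in `L²(ν)`,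
on its maximal domain `{f ∈ L²(ν) : s f(s) ∈ L²(ν)}`. -/
def mulVar (ν : Measure ℝ) : Lp ℂ 2 ν →ₗ.[ℂ] Lp ℂ 2 ν where
  domain := weightDomain ν fun s => (s : ℂ)
  toFun :=
    { toFun := fun f => MemLp.toLp (fun s : ℝ => (s : ℂ) * (f : Lp ℂ 2 ν) s) (mem_weightDomain.1 f.2)
      map_add' := fun f g => by
        rw [← MemLp.toLp_add, MemLp.toLp_eq_toLp_iff]
        exact weight_add _ (f : Lp ℂ 2 ν) (g : Lp ℂ 2 ν)
      map_smul' := fun c f => by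
        rw [RingHom.id_apply, ← MemLp.toLp_const_smul, MemLp.toLp_eq_toLp_iff]
        exact weight_smul _ c (f : Lp ℂ 2 ν) }

/-- The form domain `H₁(M_t) = L²((1 + |t|) dμ)` of the multiplication operator `M_t`, as a
subspace of `L²(μ)`. -/
def formDomain (μ : Measure ℝ) : Submodule ℂ (Lp ℂ 2 μ) :=
  weightDomain μ fun t => (√(1 + |t|) : ℂ)

/-- By Cauchy--Schwarz the pairing `(f, 1) = ∫ f dμ` is an absolutely convergent integral for `f`
in the form domain, when `1` belongs to `H₋₁(M_t)`. -/
theorem FormBounded.integrable {μ : Measure ℝ} (hμ : FormBounded μ) {f : Lp ℂ 2 μ}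
    (hf : f ∈ formDomain μ) : Integrable f μ := by
  have hf' : MemLp (fun t : ℝ => (√(1 + |t|) : ℂ) * f t) 2 μ := hf
  have hcont : Continuous (fun t : ℝ => (((√(1 + |t|))⁻¹ : ℝ) : ℂ)) := by
    refine Complex.continuous_ofReal.comp (Continuous.inv₀ (by fun_prop) ?_)
    intro t
    positivity
  have hw : MemLp (fun t : ℝ => (((√(1 + |t|))⁻¹ : ℝ) : ℂ)) 2 μ := by
    rw [memLp_two_iff_integrable_sq_norm hcont.aestronglyMeasurable]
    refine hμ.congr (Filter.Eventually.of_forall fun t => ?_)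
    have h : (0 : ℝ) ≤ 1 + |t| := by positivity
    simp only [Complex.norm_real, norm_inv, Real.norm_eq_abs, inv_pow, sq_abs, Real.sq_sqrt h]
  refine (hw.integrable_mul hf').congr (Filter.Eventually.of_forall fun t => ?_)
  have h : (√(1 + |t|) : ℂ) ≠ 0 := by
    have : √(1 + |t|) ≠ 0 := by positivity
    exact_mod_cast this
  simp only [Pi.mul_apply, Complex.ofReal_inv]
  field_simp

/-- The function `t ↦ t f(t) + α ∫ f dμ`, that is, `M_t f + α (f, φ) φ` with `φ = 1`. -/
def pertFun (μ : Measure ℝ) (α : ℝ) (f : Lp ℂ 2 μ) (t : ℝ) : ℂ :=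
  (t : ℂ) * f t + (α : ℂ) * ∫ x, f x ∂μ

theorem pertFun_zero (μ : Measure ℝ) (α : ℝ) : pertFun μ α 0 =ᵐ[μ] 0 := by
  have hI : ∫ x, (0 : Lp ℂ 2 μ) x ∂μ = 0 := by
    rw [integral_congr_ae (Lp.coeFn_zero ℂ 2 μ)]
    exact integral_zero ℝ ℂ
  filter_upwards [Lp.coeFn_zero ℂ 2 μ] with t ht
  rw [pertFun, hI, ht]
  change (t : ℂ) * 0 + (α : ℂ) * 0 = 0
  ring

theorem pertFun_add {μ : Measure ℝ} (hμ : FormBounded μ) (α : ℝ) {f g : Lp ℂ 2 μ}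
    (hf : f ∈ formDomain μ) (hg : g ∈ formDomain μ) :
    pertFun μ α (f + g) =ᵐ[μ] pertFun μ α f + pertFun μ α g := by
  have hI : ∫ x, (f + g) x ∂μ = ∫ x, f x ∂μ + ∫ x, g x ∂μ := by
    rw [integral_congr_ae (Lp.coeFn_add f g),
      integral_add' (hμ.integrable hf) (hμ.integrable hg)]
  filter_upwards [Lp.coeFn_add f g] with t ht
  rw [Pi.add_apply, pertFun, pertFun, pertFun, hI, ht, Pi.add_apply]
  ring

theorem pertFun_smul {μ : Measure ℝ} (α : ℝ) (c : ℂ) (f : Lp ℂ 2 μ) :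
    pertFun μ α (c • f) =ᵐ[μ] c • pertFun μ α f := by
  have hI : ∫ x, (c • f) x ∂μ = c * ∫ x, f x ∂μ := by
    rw [integral_congr_ae (Lp.coeFn_smul c f), ← smul_eq_mul, ← integral_smul]
    rfl
  filter_upwards [Lp.coeFn_smul c f] with t ht
  rw [Pi.smul_apply, pertFun, pertFun, hI, ht, Pi.smul_apply, smul_eq_mul, smul_eq_mul]
  ring

/-- The form bounded rank one perturbation `A_α = M_t + α (·, φ) φ`, `φ = 1`, in `L²(μ)`:
for `f` in the form domain `H₁` of `M_t`, the element `M_t f + α (f, φ) φ` of `H₋₁` is the function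
`t ↦ t f(t) + α ∫ f dμ`; the domain of `A_α` consists of those `f ∈ H₁` for which it belongs to
`L²(μ)`, and there `A_α f` is this function. This is the self-adjoint operator associated with the
quadratic form `∫ t |f|² dμ + α |∫ f dμ|²` on `H₁`. -/
def rankOnePert (μ : Measure ℝ) (hμ : FormBounded μ) (α : ℝ) :
    Lp ℂ 2 μ →ₗ.[ℂ] Lp ℂ 2 μ where
  domain :=
    { carrier := {f | f ∈ formDomain μ ∧ MemLp (pertFun μ α f) 2 μ}
      zero_mem' := ⟨Submodule.zero_mem _, (MemLp.zero (ε := ℂ)).ae_eq (pertFun_zero μ α).symm⟩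
      add_mem' := fun {f g} hf hg => ⟨Submodule.add_mem _ hf.1 hg.1,
        (MemLp.add hf.2 hg.2).ae_eq (pertFun_add hμ α hf.1 hg.1).symm⟩
      smul_mem' := fun c f hf => ⟨Submodule.smul_mem _ c hf.1,
        (MemLp.const_smul hf.2 c).ae_eq (pertFun_smul α c f).symm⟩ }
  toFun :=
    { toFun := fun f => MemLp.toLp (pertFun μ α f) f.2.2
      map_add' := fun f g => by
        rw [← MemLp.toLp_add, MemLp.toLp_eq_toLp_iff]
        exact pertFun_add hμ α f.2.1 g.2.1
      map_smul' := fun c f => by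
        rw [RingHom.id_apply, ← MemLp.toLp_const_smul, MemLp.toLp_eq_toLp_iff]
        exact pertFun_smul α c (f : Lp ℂ 2 μ) }

/-- The identity `U A = B U` between (unbounded) operators, equality of domains included: `f` lies
in the domain of `A` iff `U f` lies in the domain of `B`, and then `U (A f) = B (U f)`. -/
def Intertwines {H K : Type*} [NormedAddCommGroup H] [NormedSpace ℂ H]
    [NormedAddCommGroup K] [NormedSpace ℂ K] (U : H ≃ₗᵢ[ℂ] K)
    (A : H →ₗ.[ℂ] H) (B : K →ₗ.[ℂ] K) : Prop :=
  (∀ f : H, f ∈ A.domain ↔ U f ∈ B.domain) ∧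
    ∀ (f : A.domain) (g : B.domain), U (f : H) = (g : K) → U (A f) = B g

end RankOneRigidity

end

open RankOneRigidity

open MeasureTheory Filter
open scoped ComplexConjugate InnerProduct Topology

noncomputable section

/-! Write `res z` for the Cauchy kernel 1/(t - z) with z nonreal, and F(z) = 1 + α ∫ `res z` dμ. The
formula defining V almost commutes with multiplication by `res z`. The difference quotient obeys a
Leibniz rule and that of `res z` factors as -`res z s` * `res z t`, so the commutator has rank one
(`map_mulOp_res`). Formally V1 = 1, whence V sends `res z` to F(z) `res z` (`map_resLp`). Since F(z)
≠ 0, the Krein formula for the resolvent R(z) of A_α absorbs the rank one defect, and V R(z) = `res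
z` V exactly (`map_pertResolvent`).

Using this at z and, after taking adjoints, at the conjugate of z, VV* commutes with multiplication
by `res z`. A single such kernel already separates the points of the line, so VV* is multiplication
by a bounded function ψ ≥ 0 (`exists_symbol`). It is positive a.e.: a function living on {ψ = 0} is
orthogonal to the range of V, which contains a nowhere vanishing Cauchy kernel
(`exists_pos_symbol`).

The polar decomposition now reads V = √ψ U, with U unitary because both V and √ψ are injective
(`exists_unitary_factor`). Thus h = ψ^(-1/2), and 1/h = √ψ is bounded. As √ψ commutes with `res z`,
U carries R(z) to multiplication by `res z`. The domains are the ranges of these resolvents, so the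
operators themselves are intertwined, domains included. -/

namespace RankOneRigidity

/-! ### Multiplication operators on L² -/

/-- The bounded operator of multiplication by an essentially bounded function. -/
def mulOp {ρ : Measure ℝ} {φ : ℝ → ℂ} (hφ : MemLp φ ⊤ ρ) : Lp ℂ 2 ρ →L[ℂ] Lp ℂ 2 ρ :=
  (ContinuousLinearMap.mul ℂ ℂ).holderL ρ ⊤ 2 2 (hφ.toLp φ)

theorem mulOp_coeFn {ρ : Measure ℝ} {φ : ℝ → ℂ} (hφ : MemLp φ ⊤ ρ) (f : Lp ℂ 2 ρ) :
    mulOp hφ f =ᵐ[ρ] fun t => φ t * f t := by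
  have h : mulOp hφ f =ᵐ[ρ] fun t => hφ.toLp φ t * f t :=
    (ContinuousLinearMap.mul ℂ ℂ).coeFn_holder (r := 2) (hφ.toLp φ) f
  filter_upwards [h, hφ.coeFn_toLp] with t h1 h2
  rw [h1, h2]

theorem memLp_top_conj {ρ : Measure ℝ} {φ : ℝ → ℂ} (hφ : MemLp φ ⊤ ρ) :
    MemLp (fun t => conj (φ t)) ⊤ ρ :=
  hφ.star

theorem mulOp_congr {ρ : Measure ℝ} {φ ψ : ℝ → ℂ} (hφ : MemLp φ ⊤ ρ) (hψ : MemLp ψ ⊤ ρ)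
    (h : φ =ᵐ[ρ] ψ) : mulOp hφ = mulOp hψ := by
  ext1 f
  refine Lp.ext ?_
  filter_upwards [mulOp_coeFn hφ f, mulOp_coeFn hψ f, h] with t h1 h2 h3
  rw [h1, h2, h3]

theorem adjoint_mulOp {ρ : Measure ℝ} {φ : ℝ → ℂ} (hφ : MemLp φ ⊤ ρ) :
    ContinuousLinearMap.adjoint (mulOp hφ) = mulOp (memLp_top_conj hφ) := by
  symm
  rw [ContinuousLinearMap.eq_adjoint_iff]
  intro f g
  rw [L2.inner_def, L2.inner_def]
  refine integral_congr_ae ?_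
  filter_upwards [mulOp_coeFn hφ g, mulOp_coeFn (memLp_top_conj hφ) f] with t h1 h2
  simp only [h1, h2, RCLike.inner_apply, map_mul, Complex.conj_conj]
  ring

theorem mulOp_comp_mulOp {ρ : Measure ℝ} {φ ψ χ : ℝ → ℂ} (hφ : MemLp φ ⊤ ρ) (hψ : MemLp ψ ⊤ ρ)
    (hχ : MemLp χ ⊤ ρ) (h : ∀ᵐ t ∂ρ, φ t * ψ t = χ t) : mulOp hφ * mulOp hψ = mulOp hχ := by
  ext1 f
  refine Lp.ext ?_
  filter_upwards [mulOp_coeFn hφ (mulOp hψ f), mulOp_coeFn hψ f, mulOp_coeFn hχ f, h]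
    with t h1 h2 h3 h4
  rw [mul_apply_eq_comp, h1, h2, h3, ← h4, mul_assoc]

theorem mulOp_commute {ρ : Measure ℝ} {φ ψ : ℝ → ℂ} (hφ : MemLp φ ⊤ ρ) (hψ : MemLp ψ ⊤ ρ) :
    Commute (mulOp hφ) (mulOp hψ) := by
  have h : MemLp (fun t => φ t * ψ t) ⊤ ρ := hψ.mul hφ
  rw [commute_iff_eq, mulOp_comp_mulOp hφ hψ h (by simp),
    mulOp_comp_mulOp hψ hφ h (by simp [mul_comm])]

theorem memLp_top_bcf (ρ : Measure ℝ) (φ : BoundedContinuousFunction ℝ ℂ) : MemLp φ ⊤ ρ :=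
  memLp_top_of_bound φ.continuous.aestronglyMeasurable ‖φ‖
    (Filter.Eventually.of_forall φ.norm_coe_le_norm)

/-! ### Operators commuting with a point separating algebra -/

/-- The star subalgebra of those bounded continuous functions whose multiplication operators
commute with a given self-adjoint operator. -/
def commutantAlgebra {ρ : Measure ℝ} (T : Lp ℂ 2 ρ →L[ℂ] Lp ℂ 2 ρ) (hT : IsSelfAdjoint T) :
    StarSubalgebra ℂ (BoundedContinuousFunction ℝ ℂ) where
  carrier := {φ | Commute T (mulOp (memLp_top_bcf ρ φ))}
  mul_mem' := fun {φ ψ} h1 h2 => by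
    have := h1.mul_right h2
    rwa [mulOp_comp_mulOp _ _ (memLp_top_bcf ρ (φ * ψ)) (by simp)] at this
  add_mem' := fun {φ ψ} h1 h2 => by
    have h3 := h1.add_right h2
    have h4 : mulOp (memLp_top_bcf ρ φ) + mulOp (memLp_top_bcf ρ ψ) =
        mulOp (memLp_top_bcf ρ (φ + ψ)) := by
      ext1 f
      refine Lp.ext ?_
      filter_upwards [mulOp_coeFn (memLp_top_bcf ρ φ) f, mulOp_coeFn (memLp_top_bcf ρ ψ) f,
        mulOp_coeFn (memLp_top_bcf ρ (φ + ψ)) f,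
        Lp.coeFn_add (mulOp (memLp_top_bcf ρ φ) f) (mulOp (memLp_top_bcf ρ ψ) f)]
        with t h1 h2 h3 h4
      rw [add_apply, h4, Pi.add_apply, h1, h2, h3,
        BoundedContinuousFunction.add_apply, add_mul]
    rwa [h4] at h3
  algebraMap_mem' := fun c => by
    have h4 : mulOp (memLp_top_bcf ρ (algebraMap ℂ (BoundedContinuousFunction ℝ ℂ) c)) =
        algebraMap ℂ (Lp ℂ 2 ρ →L[ℂ] Lp ℂ 2 ρ) c := by
      ext1 f
      refine Lp.ext ?_
      filter_upwards [mulOp_coeFn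
        (memLp_top_bcf ρ (algebraMap ℂ (BoundedContinuousFunction ℝ ℂ) c)) f,
        Lp.coeFn_smul c f] with t h1 h2
      rw [h1, ContinuousLinearMap.algebraMap_apply, h2]
      simp
    change Commute _ _
    rw [h4]
    exact Algebra.commutes' c T |>.symm
  star_mem' := fun {φ} h => by
    have h2 := Commute.star_star h
    rw [hT.star_eq, ContinuousLinearMap.star_eq_adjoint, adjoint_mulOp] at h2
    exact h2

/-- The positive and negative parts of g are densities of two finite measures with equal integrals
over the algebra. Finite Borel measures on a Polish space are determined by a point separating star
algebra of bounded continuous functions, so the two parts agree a.e.; one of them is always zero. -/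
theorem ae_eq_zero_of_integral_subalgebra_real {ρ : Measure ℝ}
    {A : StarSubalgebra ℂ (BoundedContinuousFunction ℝ ℂ)}
    (hA : (A.map (BoundedContinuousFunction.toContinuousMapStarₐ ℂ)).SeparatesPoints)
    {g : ℝ → ℝ} (hg : Integrable g ρ) (h : ∀ φ ∈ A, ∫ t, φ t * (g t : ℂ) ∂ρ = 0) :
    g =ᵐ[ρ] 0 := by
  have hm : AEMeasurable (fun t => ENNReal.ofReal (g t)) ρ := hg.aemeasurable.ennreal_ofReal
  have hm' : AEMeasurable (fun t => ENNReal.ofReal (-g t)) ρ := hg.neg.aemeasurable.ennreal_ofReal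
  have hfin : ∫⁻ t, ENNReal.ofReal (g t) ∂ρ ≠ ⊤ := hg.lintegral_lt_top.ne
  have hfin' : ∫⁻ t, ENNReal.ofReal (-g t) ∂ρ ≠ ⊤ := hg.neg.lintegral_lt_top.ne
  have : IsFiniteMeasure (ρ.withDensity fun t => ENNReal.ofReal (g t)) :=
    isFiniteMeasure_withDensity hfin
  have : IsFiniteMeasure (ρ.withDensity fun t => ENNReal.ofReal (-g t)) :=
    isFiniteMeasure_withDensity hfin'
  have key : (ρ.withDensity fun t => ENNReal.ofReal (g t)) =
      ρ.withDensity fun t => ENNReal.ofReal (-g t) := by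
    refine ext_of_forall_mem_subalgebra_integral_eq_of_polish hA fun φ hφ => ?_
    rw [integral_withDensity_eq_integral_toReal_smul₀ hm (by simp),
      integral_withDensity_eq_integral_toReal_smul₀ hm' (by simp), ← sub_eq_zero, ← integral_sub]
    · rw [← h φ hφ]
      refine integral_congr_ae (Filter.Eventually.of_forall fun t => ?_)
      have h1 : (ENNReal.ofReal (g t)).toReal - (ENNReal.ofReal (-g t)).toReal = g t := by
        rw [ENNReal.toReal_ofReal', ENNReal.toReal_ofReal', max_zero_sub_max_neg_zero_eq_self]
      simp only [Complex.real_smul]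
      rw [← sub_mul, ← Complex.ofReal_sub, h1, mul_comm]
    · simp only [Complex.real_smul, mul_comm _ (φ _)]
      have : Integrable (fun t => ((ENNReal.ofReal (g t)).toReal : ℂ)) ρ :=
        (integrable_toReal_of_lintegral_ne_top hm hfin).ofReal
      exact this.bdd_mul φ.continuous.aestronglyMeasurable
        (Filter.Eventually.of_forall φ.norm_coe_le_norm)
    · simp only [Complex.real_smul, mul_comm _ (φ _)]
      have : Integrable (fun t => ((ENNReal.ofReal (-g t)).toReal : ℂ)) ρ :=
        (integrable_toReal_of_lintegral_ne_top hm' hfin').ofReal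
      exact this.bdd_mul φ.continuous.aestronglyMeasurable
        (Filter.Eventually.of_forall φ.norm_coe_le_norm)
  rw [withDensity_eq_iff hm hm' hfin] at key
  filter_upwards [key] with t ht
  have h1 := congrArg ENNReal.toReal ht
  rw [ENNReal.toReal_ofReal', ENNReal.toReal_ofReal'] at h1
  have := max_zero_sub_max_neg_zero_eq_self (g t)
  rw [Pi.zero_apply]
  linarith

/-- The algebra is closed under conjugation, so it also annihilates the conjugate of G, hence the
real and imaginary parts separately. -/
theorem ae_eq_zero_of_integral_subalgebra {ρ : Measure ℝ}
    {A : StarSubalgebra ℂ (BoundedContinuousFunction ℝ ℂ)}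
    (hA : (A.map (BoundedContinuousFunction.toContinuousMapStarₐ ℂ)).SeparatesPoints)
    {G : ℝ → ℂ} (hG : Integrable G ρ) (h : ∀ φ ∈ A, ∫ t, φ t * G t ∂ρ = 0) :
    G =ᵐ[ρ] 0 := by
  have hint : ∀ φ : BoundedContinuousFunction ℝ ℂ, Integrable (fun t => φ t * G t) ρ := fun φ =>
    hG.bdd_mul φ.continuous.aestronglyMeasurable (Filter.Eventually.of_forall φ.norm_coe_le_norm)
  have hint' : ∀ φ : BoundedContinuousFunction ℝ ℂ,
      Integrable (fun t => φ t * conj (G t)) ρ := fun φ =>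
    (Complex.conjLIE.integrable_comp_iff.2 hG).bdd_mul φ.continuous.aestronglyMeasurable
      (Filter.Eventually.of_forall φ.norm_coe_le_norm)
  have h' : ∀ φ ∈ A, ∫ t, φ t * conj (G t) ∂ρ = 0 := by
    intro φ hφ
    have h1 := h (star φ) (star_mem hφ)
    have h2 := congrArg conj h1
    rw [← integral_conj, map_zero] at h2
    simpa using h2
  have hre : (fun t => (G t).re) =ᵐ[ρ] 0 := by
    refine ae_eq_zero_of_integral_subalgebra_real hA hG.re fun φ hφ => ?_
    have h1 : ∀ t, φ t * ((G t).re : ℂ) = (1 / 2 : ℂ) * (φ t * G t + φ t * conj (G t)) := by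
      intro t
      rw [Complex.re_eq_add_conj]
      ring
    change ∫ t, φ t * ((G t).re : ℂ) ∂ρ = 0
    simp_rw [h1]
    rw [integral_const_mul, integral_add (hint φ) (hint' φ), h φ hφ, h' φ hφ]
    simp
  have him : (fun t => (G t).im) =ᵐ[ρ] 0 := by
    refine ae_eq_zero_of_integral_subalgebra_real hA hG.im fun φ hφ => ?_
    have h1 : ∀ t, φ t * ((G t).im : ℂ) =
        (1 / (2 * Complex.I) : ℂ) * (φ t * G t - φ t * conj (G t)) := by
      intro t
      rw [Complex.im_eq_sub_conj]
      ring
    change ∫ t, φ t * ((G t).im : ℂ) ∂ρ = 0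
    simp_rw [h1]
    rw [integral_const_mul, integral_sub (hint φ) (hint' φ), h φ hφ, h' φ hφ]
    simp
  filter_upwards [hre, him] with t h1 h2
  exact Complex.ext h1 h2

/-- If a self-adjoint operator on `L²(ρ)` commutes with multiplication by the elements of a point
separating algebra, then `T x · ȳ = x · conj (T y)` almost everywhere. -/
theorem apply_mul_conj_ae_eq {ρ : Measure ℝ} {T : Lp ℂ 2 ρ →L[ℂ] Lp ℂ 2 ρ} (hT : IsSelfAdjoint T)
    (hA : ((commutantAlgebra T hT).map
      (BoundedContinuousFunction.toContinuousMapStarₐ ℂ)).SeparatesPoints) (x y : Lp ℂ 2 ρ) :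
    (fun t => T x t * conj (y t)) =ᵐ[ρ] fun t => x t * conj (T y t) := by
  have hi : ∀ u v : Lp ℂ 2 ρ, Integrable (fun t => u t * conj (v t)) ρ := fun u v => by
    simpa only [RCLike.inner_apply] using L2.integrable_inner (𝕜 := ℂ) v u
  have key : (fun t => T x t * conj (y t) - x t * conj (T y t)) =ᵐ[ρ] 0 := by
    refine ae_eq_zero_of_integral_subalgebra hA ((hi _ _).sub (hi _ _)) fun φ hφ => ?_
    have hc : T (mulOp (memLp_top_bcf ρ φ) x) = mulOp (memLp_top_bcf ρ φ) (T x) :=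
      congrArg (fun S : Lp ℂ 2 ρ →L[ℂ] Lp ℂ 2 ρ => S x) (show Commute _ _ from hφ).eq
    -- Commutation moves φ inside T, and self-adjointness then moves T onto y.
    have h1 : inner ℂ y (mulOp (memLp_top_bcf ρ φ) (T x)) =
        inner ℂ (T y) (mulOp (memLp_top_bcf ρ φ) x) := by
      rw [← hc, ← ContinuousLinearMap.adjoint_inner_left, ← ContinuousLinearMap.star_eq_adjoint,
        hT.star_eq]
    rw [L2.inner_def, L2.inner_def, ← sub_eq_zero, ← integral_sub] at h1
    · rw [← h1]
      refine integral_congr_ae ?_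
      filter_upwards [mulOp_coeFn (memLp_top_bcf ρ φ) (T x), mulOp_coeFn (memLp_top_bcf ρ φ) x]
        with t h2 h3
      rw [h2, h3, RCLike.inner_apply, RCLike.inner_apply]
      ring
    · exact L2.integrable_inner _ _
    · exact L2.integrable_inner _ _
  filter_upwards [key] with t ht
  exact sub_eq_zero.1 ht

/-! ### The Cauchy kernel: decay and integrability -/

/-- The Cauchy kernel `t ↦ (t - z)⁻¹` on the real line. -/
def res (z : ℂ) (t : ℝ) : ℂ := ((t : ℂ) - z)⁻¹

theorem ofReal_sub_ne_zero {z : ℂ} (hz : z.im ≠ 0) (t : ℝ) : (t : ℂ) - z ≠ 0 := by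
  intro h
  have := congrArg Complex.im h
  simp [hz] at this

theorem sub_mul_res {z : ℂ} (hz : z.im ≠ 0) (t : ℝ) : ((t : ℂ) - z) * res z t = 1 :=
  mul_inv_cancel₀ (ofReal_sub_ne_zero hz t)

theorem res_ne_zero {z : ℂ} (hz : z.im ≠ 0) (t : ℝ) : res z t ≠ 0 :=
  inv_ne_zero (ofReal_sub_ne_zero hz t)

theorem contDiff_res {z : ℂ} (hz : z.im ≠ 0) : ContDiff ℝ 1 (res z) := by
  have h1 : ContDiff ℝ 1 fun t : ℝ => (t : ℂ) - z :=
    Complex.ofRealCLM.contDiff.sub contDiff_const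
  exact h1.inv (ofReal_sub_ne_zero hz)

theorem hasDerivAt_res {z : ℂ} (hz : z.im ≠ 0) (t : ℝ) :
    HasDerivAt (res z) (-(res z t * res z t)) t := by
  have h1 : HasDerivAt (fun t : ℝ => (t : ℂ) - z) 1 t := Complex.ofRealCLM.hasDerivAt.sub_const z
  convert! h1.inv (ofReal_sub_ne_zero hz t) using 1
  rw [res]
  field_simp

theorem exists_norm_res_le {z : ℂ} (hz : z.im ≠ 0) :
    ∃ K : ℝ, 0 ≤ K ∧ ∀ t, ‖res z t‖ ≤ K * (1 + |t|)⁻¹ := by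
  have hy : 0 < |z.im| := abs_pos.2 hz
  -- The constant comes from 1 + |t| ≤ (1 + ‖z‖) + ‖t - z‖ together with ‖t - z‖ ≥ |Im z|.
  refine ⟨1 + (1 + ‖z‖) / |z.im|, by positivity, fun t => ?_⟩
  have h1 : |z.im| ≤ ‖(t : ℂ) - z‖ := by
    simpa using Complex.abs_im_le_norm ((t : ℂ) - z)
  have h2 : |t| ≤ ‖(t : ℂ) - z‖ + ‖z‖ := by
    simpa using norm_add_le ((t : ℂ) - z) z
  have h3 : 0 < ‖(t : ℂ) - z‖ := hy.trans_le h1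
  rw [res, norm_inv, ← div_eq_mul_inv, inv_eq_one_div, div_le_div_iff₀ h3 (by positivity), one_mul]
  have h4 : 1 + ‖z‖ ≤ (1 + ‖z‖) / |z.im| * ‖(t : ℂ) - z‖ := by
    rw [div_mul_eq_mul_div, le_div_iff₀ hy]
    gcongr
  linarith

theorem continuous_res {z : ℂ} (hz : z.im ≠ 0) : Continuous (res z) := (contDiff_res hz).continuous

theorem exists_norm_res_le_const {z : ℂ} (hz : z.im ≠ 0) : ∃ K : ℝ, ∀ t, ‖res z t‖ ≤ K := by
  obtain ⟨K, hK, h⟩ := exists_norm_res_le hz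
  refine ⟨K, fun t => (h t).trans ?_⟩
  exact mul_le_of_le_one_right hK (inv_le_one_of_one_le₀ (by linarith [abs_nonneg t]))

theorem memLp_top_res {z : ℂ} (hz : z.im ≠ 0) (ρ : Measure ℝ) : MemLp (res z) ⊤ ρ := by
  obtain ⟨K, h⟩ := exists_norm_res_le_const hz
  exact memLp_top_of_bound (continuous_res hz).aestronglyMeasurable K (Eventually.of_forall h)

theorem integrable_res {z : ℂ} (hz : z.im ≠ 0) {μ : Measure ℝ} (hμ : FormBounded μ) :
    Integrable (res z) μ := by
  obtain ⟨K, hK, h⟩ := exists_norm_res_le hz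
  exact (hμ.const_mul K).mono' (continuous_res hz).aestronglyMeasurable (Eventually.of_forall h)

/-- Places the Cauchy kernel in the form domain: the squared modulus is of order 1/(1 + |t|),
exactly what `FormBounded` integrates. -/
theorem memLp_sqrt_mul_res {z : ℂ} (hz : z.im ≠ 0) {μ : Measure ℝ} (hμ : FormBounded μ) :
    MemLp (fun t : ℝ => (√(1 + |t|) : ℂ) * res z t) 2 μ := by
  obtain ⟨K, hK, h⟩ := exists_norm_res_le hz
  have hc : Continuous fun t : ℝ => (√(1 + |t|) : ℂ) * res z t :=
    (Complex.continuous_ofReal.comp (by fun_prop)).mul (continuous_res hz)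
  rw [memLp_two_iff_integrable_sq_norm hc.aestronglyMeasurable]
  refine (hμ.const_mul (K ^ 2)).mono' (hc.norm.pow 2).aestronglyMeasurable
    (Eventually.of_forall fun t => ?_)
  have h0 : (0 : ℝ) < 1 + |t| := by positivity
  rw [Real.norm_of_nonneg (by positivity), norm_mul, mul_pow, Complex.norm_real,
    Real.norm_of_nonneg (Real.sqrt_nonneg _), Real.sq_sqrt h0.le]
  calc (1 + |t|) * ‖res z t‖ ^ 2 ≤ (1 + |t|) * (K * (1 + |t|)⁻¹) ^ 2 := by
        gcongr
        exact h t
    _ = K ^ 2 * (1 + |t|)⁻¹ := by field_simp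

theorem memLp_res {z : ℂ} (hz : z.im ≠ 0) {μ : Measure ℝ} (hμ : FormBounded μ) :
    MemLp (res z) 2 μ := by
  refine (memLp_sqrt_mul_res hz hμ).mono (continuous_res hz).aestronglyMeasurable
    (Eventually.of_forall fun t => ?_)
  rw [norm_mul, Complex.norm_real, Real.norm_of_nonneg (Real.sqrt_nonneg _)]
  refine le_mul_of_one_le_left (norm_nonneg _) ?_
  rw [Real.one_le_sqrt]
  linarith [abs_nonneg t]

/-- Boundedness of this weight means that multiplication by `res z` maps all of L² into the form
domain. -/
theorem memLp_top_sqrt_mul_res {z : ℂ} (hz : z.im ≠ 0) (μ : Measure ℝ) :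
    MemLp (fun t : ℝ => (√(1 + |t|) : ℂ) * res z t) ⊤ μ := by
  obtain ⟨K, hK, h⟩ := exists_norm_res_le hz
  have hc : Continuous fun t : ℝ => (√(1 + |t|) : ℂ) * res z t :=
    (Complex.continuous_ofReal.comp (by fun_prop)).mul (continuous_res hz)
  refine memLp_top_of_bound hc.aestronglyMeasurable K (Eventually.of_forall fun t => ?_)
  have h0 : (0 : ℝ) < 1 + |t| := by positivity
  rw [norm_mul, Complex.norm_real, Real.norm_of_nonneg (Real.sqrt_nonneg _)]
  calc √(1 + |t|) * ‖res z t‖ ≤ (1 + |t|) * (K * (1 + |t|)⁻¹) := by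
        refine mul_le_mul ?_ (h t) (norm_nonneg _) h0.le
        rw [Real.sqrt_le_left h0.le]
        nlinarith [abs_nonneg t]
    _ = K := by field_simp

theorem conj_res (z : ℂ) (t : ℝ) : conj (res z t) = res (conj z) t := by
  simp [res]

/-! ### Difference quotients -/

section Slope

variable {f : ℝ → ℂ} {B L : ℝ}

theorem norm_dslope_le (hf : Differentiable ℝ f) (hL : ∀ t, ‖deriv f t‖ ≤ L) (s t : ℝ) :
    ‖dslope f s t‖ ≤ L := by
  rcases eq_or_ne t s with rfl | h
  · simpa using hL t
  · rw [dslope_of_ne _ h, slope_def_module, norm_smul, norm_inv,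
      inv_mul_le_iff₀ (norm_pos_iff.2 (sub_ne_zero.2 h)), mul_comm]
    exact convex_univ.norm_image_sub_le_of_norm_deriv_le (fun x _ => hf x) (fun x _ => hL x)
      (Set.mem_univ s) (Set.mem_univ t)

/-- Since 1 + |t| ≤ (1 + |s|) + |t - s|, the Lipschitz bound L handles the first summand and the
increment bound 2B the second. This gives a μ-integrable majorant for each fixed s. -/
theorem norm_dslope_le_inv (hf : Differentiable ℝ f) (hL : ∀ t, ‖deriv f t‖ ≤ L)
    (hB : ∀ t, ‖f t‖ ≤ B) (s t : ℝ) :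
    ‖dslope f s t‖ ≤ (L * (1 + |s|) + 2 * B) * (1 + |t|)⁻¹ := by
  have h0 : (0 : ℝ) < 1 + |t| := by positivity
  rw [← div_eq_mul_inv, le_div_iff₀ h0]
  have h1 := norm_dslope_le hf hL s t
  have h2 : |t - s| * ‖dslope f s t‖ ≤ 2 * B := by
    rw [← Real.norm_eq_abs, ← norm_smul, sub_smul_dslope]
    linarith [norm_sub_le (f t) (f s), hB t, hB s]
  have h3 : |t| ≤ |s| + |t - s| := by
    linarith [abs_sub_abs_le_abs_sub t s]
  have h4 : ‖dslope f s t‖ * (1 + |t|) ≤ ‖dslope f s t‖ * (1 + |s| + |t - s|) :=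
    mul_le_mul_of_nonneg_left (by linarith) (norm_nonneg _)
  have h5 : ‖dslope f s t‖ * (1 + |s|) ≤ L * (1 + |s|) := by gcongr
  linarith

theorem continuous_dslope (hf : Differentiable ℝ f) (s : ℝ) : Continuous (dslope f s) := by
  rw [← continuousOn_univ, continuousOn_dslope univ_mem]
  exact ⟨hf.continuous.continuousOn, hf s⟩

theorem integrable_dslope {μ : Measure ℝ} (hμ : FormBounded μ) (hf : ContDiff ℝ 1 f)
    (hc : HasCompactSupport f) (s : ℝ) : Integrable (dslope f s) μ := by
  obtain ⟨B, hB⟩ := hc.exists_bound_of_continuous hf.continuous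
  obtain ⟨L, hL⟩ := hc.deriv.exists_bound_of_continuous (hf.continuous_deriv le_rfl)
  have hd : Differentiable ℝ f := hf.differentiable one_ne_zero
  exact (hμ.const_mul (L * (1 + |s|) + 2 * B)).mono'
    (continuous_dslope hd s).aestronglyMeasurable
    (Eventually.of_forall fun t => norm_dslope_le_inv hd hL hB s t)

/-- Leibniz rule combined with 1/(t - z) - 1/(s - z) = -(t - s)/((t - z)(s - z)). The second term
splits into a function of s times a function of t, which is the source of the rank one commutator.
-/
theorem dslope_res_mul {z : ℂ} (hz : z.im ≠ 0) (hf : Differentiable ℝ f) (s t : ℝ) :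
    dslope (fun x => res z x * f x) s t =
      res z s * dslope f s t - res z s * (res z t * f t) := by
  rcases eq_or_ne t s with rfl | h
  · rw [dslope_same, dslope_same, ((hasDerivAt_res hz t).fun_mul (hf t).hasDerivAt).deriv]
    ring
  · rw [dslope_of_ne _ h, dslope_of_ne _ h, slope_def_module, slope_def_module, Complex.real_smul,
      Complex.real_smul]
    have h1 : ((t - s : ℝ) : ℂ) ≠ 0 := by
      rw [Complex.ofReal_ne_zero]
      exact sub_ne_zero.2 h
    have h2 := ofReal_sub_ne_zero hz t
    have h3 := ofReal_sub_ne_zero hz s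
    have h4 : (t : ℂ) - s ≠ 0 := by exact_mod_cast h1
    rw [res, res]
    push_cast
    field_simp
    ring

end Slope

theorem reprV_res_mul {μ : Measure ℝ} (hμ : FormBounded μ) (α : ℝ) {z : ℂ} (hz : z.im ≠ 0)
    {f : ℝ → ℂ} (hf : ContDiff ℝ 1 f) (hc : HasCompactSupport f) (s : ℝ) :
    reprV μ α (fun x => res z x * f x) s =
      res z s * reprV μ α f s + (α : ℂ) * res z s * ∫ t, res z t * f t ∂μ := by
  have hd : Differentiable ℝ f := hf.differentiable one_ne_zero
  have hi : Integrable (fun t => res z t * f t) μ := by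
    obtain ⟨B, hB⟩ := hc.exists_bound_of_continuous hf.continuous
    exact (integrable_res hz hμ).mul_bdd hf.continuous.aestronglyMeasurable
      (Eventually.of_forall hB)
  simp only [reprV, dslope_res_mul hz hd]
  rw [integral_sub ((integrable_dslope hμ hf hc s).const_mul _) (hi.const_mul _),
    integral_const_mul, integral_const_mul]
  ring

/-! ### Approximation by compactly supported functions -/

/-- Smooth cutoff functions exhausting the line, with derivatives tending to zero. -/
theorem exists_cutoff : ∃ (χ : ℕ → ℝ → ℂ) (L : ℝ), (∀ n, ContDiff ℝ 1 (χ n)) ∧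
    (∀ n, HasCompactSupport (χ n)) ∧ (∀ n t, ‖χ n t‖ ≤ 1) ∧
    (∀ n t, ‖deriv (χ n) t‖ ≤ L / (n + 1)) ∧ ∀ t, ∀ᶠ n in atTop, χ n t = 1 := by
  -- The bump is 1 on [-1, 1] and supported in [-2, 2]; dilating it by n + 1 divides its derivative
  -- by n + 1.
  let b : ContDiffBump (0 : ℝ) := ⟨1, 2, one_pos, one_lt_two⟩
  have hb : ContDiff ℝ 1 fun t : ℝ => ((b t : ℝ) : ℂ) :=
    Complex.ofRealCLM.contDiff.comp b.contDiff
  have hbc : HasCompactSupport fun t : ℝ => ((b t : ℝ) : ℂ) :=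
    b.hasCompactSupport.comp_left Complex.ofReal_zero
  obtain ⟨L, hL⟩ := hbc.deriv.exists_bound_of_continuous (hb.continuous_deriv le_rfl)
  refine ⟨fun n t => ((b (((n : ℝ) + 1)⁻¹ * t) : ℝ) : ℂ), L, fun n => ?_, fun n => ?_,
    fun n t => ?_, fun n t => ?_, fun t => ?_⟩
  · exact hb.comp (contDiff_const.mul contDiff_id)
  · have hn : ((n : ℝ) + 1)⁻¹ ≠ 0 := by positivity
    exact hbc.comp_homeomorph (Homeomorph.mulLeft₀ _ hn)
  · rw [Complex.norm_real, Real.norm_of_nonneg b.nonneg]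
    exact b.le_one
  · have h1 : HasDerivAt (fun t : ℝ => ((n : ℝ) + 1)⁻¹ * t) ((n : ℝ) + 1)⁻¹ t := by
      simpa using (hasDerivAt_id t).const_mul ((n : ℝ) + 1)⁻¹
    have h2 := (hb.differentiable one_ne_zero (((n : ℝ) + 1)⁻¹ * t)).hasDerivAt.scomp t h1
    change ‖deriv ((fun t : ℝ => ((b t : ℝ) : ℂ)) ∘ fun t : ℝ => ((n : ℝ) + 1)⁻¹ * t) t‖ ≤ _
    rw [h2.deriv, norm_smul, Real.norm_of_nonneg (by positivity), div_eq_inv_mul]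
    gcongr
    exact hL _
  · filter_upwards [eventually_ge_atTop ⌈|t|⌉₊] with n hn
    have h1 : |t| ≤ (n : ℝ) + 1 := by
      have := Nat.ceil_le.1 hn
      linarith
    have h2 : b (((n : ℝ) + 1)⁻¹ * t) = 1 := by
      refine b.one_of_mem_closedBall ?_
      rw [mem_closedBall_zero_iff, norm_mul, Real.norm_of_nonneg (by positivity),
        Real.norm_eq_abs, inv_mul_le_iff₀ (by positivity)]
      simpa [b] using h1
    rw [h2, Complex.ofReal_one]

theorem norm_sq_eq_integral {ρ : Measure ℝ} (f : Lp ℂ 2 ρ) : ‖f‖ ^ 2 = ∫ t, ‖f t‖ ^ 2 ∂ρ := by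
  have h1 : ((‖f‖ : ℂ)) ^ 2 = inner ℂ f f := (inner_self_eq_norm_sq_to_K f).symm
  rw [L2.inner_def] at h1
  simp only [inner_self_eq_norm_sq_to_K] at h1
  have h2 : ∫ t, ((‖f t‖ : ℝ) : ℂ) ^ 2 ∂ρ = ((∫ t, ‖f t‖ ^ 2 ∂ρ : ℝ) : ℂ) := by
    simp only [← Complex.ofReal_pow]
    exact integral_ofReal
  exact_mod_cast h1.trans h2

theorem tendsto_toLp_of_dominated {ρ : Measure ℝ} {F : ℕ → ℝ → ℂ} {f : ℝ → ℂ}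
    (hF : ∀ n, MemLp (F n) 2 ρ) (hf : MemLp f 2 ρ) (hb : ∀ n t, ‖F n t‖ ≤ ‖f t‖)
    (hlim : ∀ t, Tendsto (fun n => F n t) atTop (𝓝 (f t))) :
    Tendsto (fun n => (hF n).toLp (F n)) atTop (𝓝 (hf.toLp f)) := by
  rw [tendsto_iff_norm_sub_tendsto_zero]
  have h1 : ∀ n, ‖(hF n).toLp (F n) - hf.toLp f‖ ^ 2 = ∫ t, ‖F n t - f t‖ ^ 2 ∂ρ := by
    intro n
    rw [← MemLp.toLp_sub, norm_sq_eq_integral]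
    refine integral_congr_ae ?_
    filter_upwards [((hF n).sub hf).coeFn_toLp] with t ht
    rw [ht, Pi.sub_apply]
  have h2 : Tendsto (fun n => ∫ t, ‖F n t - f t‖ ^ 2 ∂ρ) atTop (𝓝 (∫ _, (0 : ℝ) ∂ρ)) := by
    refine tendsto_integral_of_dominated_convergence (fun t => 4 * ‖f t‖ ^ 2)
      (fun n => (((hF n).sub hf).1.norm.pow 2))
      (((memLp_two_iff_integrable_sq_norm hf.1).1 hf).const_mul 4)
      (fun n => Eventually.of_forall fun t => ?_) (Eventually.of_forall fun t => ?_)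
    · rw [Real.norm_of_nonneg (by positivity)]
      have : ‖F n t - f t‖ ≤ 2 * ‖f t‖ := by linarith [norm_sub_le (F n t) (f t), hb n t]
      calc ‖F n t - f t‖ ^ 2 ≤ (2 * ‖f t‖) ^ 2 := by gcongr
        _ = 4 * ‖f t‖ ^ 2 := by ring
    · have := (tendsto_iff_norm_sub_tendsto_zero.1 (hlim t)).pow 2
      simpa using this
  rw [integral_zero] at h2
  simp only [← h1] at h2
  have h3 := (Real.continuous_sqrt.tendsto 0).comp h2
  simpa [Function.comp_def, Real.sqrt_sq (norm_nonneg _)] using h3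

theorem isFiniteMeasureOnCompacts_of_formBounded {μ : Measure ℝ} (hμ : FormBounded μ) :
    IsFiniteMeasureOnCompacts μ := by
  refine ⟨fun K hK => ?_⟩
  obtain ⟨R, hR⟩ := hK.isBounded.exists_norm_le
  refine lt_of_le_of_lt (measure_mono fun t ht => ?_)
    (hμ.measure_norm_ge_lt_top (ε := (1 + |R|)⁻¹) (by positivity))
  have h1 : |t| ≤ |R| := (hR t ht).trans (le_abs_self R)
  change (1 + |R|)⁻¹ ≤ ‖(1 + |t|)⁻¹‖
  rw [Real.norm_of_nonneg (by positivity)]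
  gcongr

/-- Two continuous maps on `L²(μ)` which agree on compactly supported `C¹` functions are equal. -/
theorem eq_of_forall_contDiff {μ : Measure ℝ} (hμ : FormBounded μ) {H : Type*}
    [NormedAddCommGroup H] [NormedSpace ℂ H] {S T : Lp ℂ 2 μ →L[ℂ] H}
    (h : ∀ (f : ℝ → ℂ) (hf : ContDiff ℝ 1 f) (hc : HasCompactSupport f),
      S ((hμ.memLp hf.continuous hc).toLp f) = T ((hμ.memLp hf.continuous hc).toLp f)) :
    S = T := by
  have := isFiniteMeasureOnCompacts_of_formBounded hμ
  have hd : Dense {f : Lp ℂ 2 μ |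
      ∃ g : ℝ → ℂ, f =ᵐ[μ] g ∧ HasCompactSupport g ∧ ContDiff ℝ (⊤ : ℕ∞) g} :=
    Lp.dense_hasCompactSupport_contDiff (by simp)
  have hst := Continuous.ext_on hd S.continuous T.continuous ?_
  · exact ContinuousLinearMap.ext fun x => congrFun hst x
  · rintro f ⟨g, hfg, hgc, hg⟩
    have hg1 : ContDiff ℝ 1 g := hg.of_le (by exact_mod_cast le_top)
    have hfg' : f = (hμ.memLp hg1.continuous hgc).toLp g :=
      Lp.ext (hfg.trans (MemLp.coeFn_toLp _).symm)
    rw [hfg']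
    exact h g hg1 hgc

/-! ### The action of V on Cauchy kernels -/

/-- The factor `1 + α ∫ (t - z)⁻¹ dμ(t)`. -/
def pertFactor (μ : Measure ℝ) (α : ℝ) (z : ℂ) : ℂ :=
  1 + (α : ℂ) * ∫ t, res z t ∂μ

theorem conj_pertFactor (μ : Measure ℝ) (α : ℝ) (z : ℂ) :
    conj (pertFactor μ α z) = pertFactor μ α (conj z) := by
  simp only [pertFactor, map_add, map_one, map_mul, Complex.conj_ofReal, ← integral_conj, conj_res]

theorem conj_im_ne_zero {z : ℂ} (hz : z.im ≠ 0) : (conj z).im ≠ 0 := by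
  simpa using hz

/-- The imaginary part equals α · Im z · ∫ |`res z`|² dμ. If it vanishes, then either α = 0 or the
kernel is zero μ-a.e., and in both cases the factor is 1. -/
theorem pertFactor_ne_zero {μ : Measure ℝ} (hμ : FormBounded μ) (α : ℝ) {z : ℂ} (hz : z.im ≠ 0) :
    pertFactor μ α z ≠ 0 := by
  intro h
  have hi := integrable_res hz hμ
  have h1 : α * ∫ t, (res z t).im ∂μ = 0 := by
    have h2 : (∫ t, res z t ∂μ).im = ∫ t, (res z t).im ∂μ := (integral_im hi).symm
    have h3 := congrArg Complex.im h
    rw [pertFactor, Complex.add_im, Complex.one_im, Complex.im_ofReal_mul, h2] at h3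
    simpa using h3
  have hα : α ≠ 0 := by
    rintro rfl
    simp [pertFactor] at h
  have h4 : ∀ t, (res z t).im = z.im * Complex.normSq (res z t) := by
    intro t
    rw [res, Complex.inv_im, Complex.normSq_inv]
    simp [div_eq_mul_inv]
  simp only [h4, integral_const_mul, mul_eq_zero, hα, hz, false_or] at h1
  have h5 : (fun t => Complex.normSq (res z t)) =ᵐ[μ] 0 := by
    refine (integral_eq_zero_iff_of_nonneg (fun t => Complex.normSq_nonneg _) ?_).1 h1
    have := (memLp_two_iff_integrable_sq_norm (memLp_res hz hμ).1).1 (memLp_res hz hμ)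
    simpa only [Complex.normSq_eq_norm_sq] using this
  have h6 : ∫ t, res z t ∂μ = 0 := by
    rw [integral_eq_zero_of_ae]
    filter_upwards [h5] with t ht
    exact Complex.normSq_eq_zero.1 ht
  rw [pertFactor, h6] at h
  simp at h

/-- The rigorous form of V1 = 1: the difference quotients of the cutoffs tend to zero uniformly,
under one common integrable majorant. -/
theorem tendsto_reprV_cutoff {μ : Measure ℝ} (hμ : FormBounded μ) (α : ℝ) {χ : ℕ → ℝ → ℂ} {L : ℝ}
    (hχ : ∀ n, ContDiff ℝ 1 (χ n)) (hb : ∀ n t, ‖χ n t‖ ≤ 1)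
    (hL : ∀ n t, ‖deriv (χ n) t‖ ≤ L / (n + 1)) (h1 : ∀ t, ∀ᶠ n in atTop, χ n t = 1) (s : ℝ) :
    Tendsto (fun n => reprV μ α (χ n) s) atTop (𝓝 1) := by
  have hd : ∀ n, Differentiable ℝ (χ n) := fun n => (hχ n).differentiable one_ne_zero
  have hL0 : 0 ≤ L := by
    have := (norm_nonneg _).trans (hL 0 0)
    simpa using this
  have hL' : ∀ n t, ‖deriv (χ n) t‖ ≤ L := fun n t =>
    (hL n t).trans (div_le_self hL0 (by linarith [Nat.cast_nonneg (α := ℝ) n]))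
  have h2 : Tendsto (fun n => ∫ t, dslope (χ n) s t ∂μ) atTop (𝓝 (∫ _, (0 : ℂ) ∂μ)) := by
    refine tendsto_integral_of_dominated_convergence _
      (fun n => (continuous_dslope (hd n) s).aestronglyMeasurable)
      (hμ.const_mul (L * (1 + |s|) + 2 * 1))
      (fun n => Eventually.of_forall fun t => norm_dslope_le_inv (hd n) (hL' n) (hb n) s t)
      (Eventually.of_forall fun t => ?_)
    refine squeeze_zero_norm (fun n => norm_dslope_le (hd n) (hL n) s t) ?_
    exact tendsto_const_nhds.div_atTop
      (tendsto_atTop_add_const_right _ _ tendsto_natCast_atTop_atTop)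
  rw [integral_zero] at h2
  have h3 : Tendsto (fun n => χ n s) atTop (𝓝 1) :=
    tendsto_const_nhds.congr' ((h1 s).mono fun n hn => hn.symm)
  simpa [reprV] using h3.sub (h2.const_mul (α : ℂ))

/-- The Cauchy kernel as an element of `L²(μ)`. -/
def resLp {μ : Measure ℝ} (hμ : FormBounded μ) {z : ℂ} (hz : z.im ≠ 0) : Lp ℂ 2 μ :=
  (memLp_res hz hμ).toLp (res z)

/-- The kernel is not compactly supported, so the formula applies only to its cutoffs. These
converge in L²(μ), so their images converge ν-a.e. along a subsequence, while the explicit formula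
converges at every point. -/
theorem map_resLp {μ ν : Measure ℝ} {hμ : FormBounded μ} {α : ℝ}
    {V : Lp ℂ 2 μ →L[ℂ] Lp ℂ 2 ν} (hV : ExtendsReprV μ ν hμ α V) {z : ℂ} (hz : z.im ≠ 0) :
    V (resLp hμ hz) =ᵐ[ν] fun s => pertFactor μ α z * res z s := by
  obtain ⟨χ, L, hχ, hχc, hb, hL, h1⟩ := exists_cutoff
  have hF : ∀ n, ContDiff ℝ 1 fun t => res z t * χ n t := fun n => (contDiff_res hz).mul (hχ n)
  have hFc : ∀ n, HasCompactSupport fun t => res z t * χ n t := fun n => (hχc n).mul_left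
  have hlim1 : ∀ t, Tendsto (fun n => χ n t) atTop (𝓝 1) := fun t =>
    tendsto_const_nhds.congr' ((h1 t).mono fun n hn => hn.symm)
  have hlim : ∀ t, Tendsto (fun n => res z t * χ n t) atTop (𝓝 (res z t)) := fun t => by
    simpa using (hlim1 t).const_mul (res z t)
  have hbd : ∀ n t, ‖res z t * χ n t‖ ≤ ‖res z t‖ := fun n t => by
    rw [norm_mul]
    exact mul_le_of_le_one_right (norm_nonneg _) (hb n t)
  have h2 : Tendsto (fun n => (hμ.memLp (hF n).continuous (hFc n)).toLp _) atTop
      (𝓝 (resLp hμ hz)) :=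
    tendsto_toLp_of_dominated _ (memLp_res hz hμ) hbd hlim
  have h3 := tendstoInMeasure_of_tendsto_Lp ((V.continuous.tendsto _).comp h2)
  obtain ⟨ns, hns, hae⟩ := h3.exists_seq_tendsto_ae
  have h4 : Tendsto (fun n => ∫ t, res z t * χ n t ∂μ) atTop (𝓝 (∫ t, res z t ∂μ)) :=
    tendsto_integral_of_dominated_convergence _ (fun n => (hF n).continuous.aestronglyMeasurable)
      (integrable_res hz hμ).norm (fun n => Eventually.of_forall (hbd n))
      (Eventually.of_forall hlim)
  have h5 : ∀ᵐ s ∂ν, ∀ n, V ((hμ.memLp (hF n).continuous (hFc n)).toLp _) s =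
      reprV μ α (fun t => res z t * χ n t) s := ae_all_iff.2 fun n => hV _ (hF n) (hFc n)
  filter_upwards [hae, h5] with s h6 h7
  refine tendsto_nhds_unique h6 ?_
  have h8 : Tendsto (fun n => reprV μ α (fun t => res z t * χ n t) s) atTop
      (𝓝 (pertFactor μ α z * res z s)) := by
    simp only [fun n => reprV_res_mul hμ α hz (hχ n) (hχc n) s]
    have h9 := ((tendsto_reprV_cutoff hμ α hχ hb hL h1 s).const_mul (res z s)).add
      (h4.const_mul ((α : ℂ) * res z s))
    convert! h9 using 2
    rw [pertFactor]
    ring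
  refine (h8.comp hns.tendsto_atTop).congr fun n => ?_
  exact (h7 (ns n)).symm

/-- Nothing is assumed about the size of ν; its control on the kernel comes from boundedness of V
and the nonvanishing of the factor. -/
theorem memLp_res_right {μ ν : Measure ℝ} {hμ : FormBounded μ} {α : ℝ}
    {V : Lp ℂ 2 μ →L[ℂ] Lp ℂ 2 ν} (hV : ExtendsReprV μ ν hμ α V) {z : ℂ} (hz : z.im ≠ 0) :
    MemLp (res z) 2 ν := by
  have h1 := (Lp.memLp (V (resLp hμ hz))).ae_eq (map_resLp hV hz)
  refine (h1.const_mul (pertFactor μ α z)⁻¹).ae_eq (Eventually.of_forall fun s => ?_)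
  rw [inv_mul_cancel_left₀ (pertFactor_ne_zero hμ α hz)]

theorem map_mulOp_res {μ ν : Measure ℝ} {hμ : FormBounded μ} {α : ℝ}
    {V : Lp ℂ 2 μ →L[ℂ] Lp ℂ 2 ν} (hV : ExtendsReprV μ ν hμ α V) {z : ℂ} (hz : z.im ≠ 0)
    (g : Lp ℂ 2 μ) :
    V (mulOp (memLp_top_res hz μ) g) = mulOp (memLp_top_res hz ν) (V g) +
      ((α : ℂ) * inner ℂ (resLp hμ (conj_im_ne_zero hz)) g) •
        (memLp_res_right hV hz).toLp (res z) := by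
  have key : V ∘L mulOp (memLp_top_res hz μ) = mulOp (memLp_top_res hz ν) ∘L V +
      (α : ℂ) • InnerProductSpace.rankOne ℂ ((memLp_res_right hV hz).toLp (res z))
        (resLp hμ (conj_im_ne_zero hz)) := by
    -- Both sides are bounded operators, so the pointwise commutator identity on compactly supported
    -- C¹ functions suffices.
    refine eq_of_forall_contDiff hμ fun f hf hc => Lp.ext ?_
    have hF : ContDiff ℝ 1 fun t => res z t * f t := (contDiff_res hz).mul hf
    have hFc : HasCompactSupport fun t => res z t * f t := hc.mul_left
    have h1 : mulOp (memLp_top_res hz μ) ((hμ.memLp hf.continuous hc).toLp f) =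
        (hμ.memLp hF.continuous hFc).toLp fun t => res z t * f t := by
      refine Lp.ext ?_
      filter_upwards [mulOp_coeFn (memLp_top_res hz μ) ((hμ.memLp hf.continuous hc).toLp f),
        (hμ.memLp hf.continuous hc).coeFn_toLp, (hμ.memLp hF.continuous hFc).coeFn_toLp]
        with t h2 h3 h4
      rw [h2, h3, h4]
    have h5 : inner ℂ (resLp hμ (conj_im_ne_zero hz)) ((hμ.memLp hf.continuous hc).toLp f) =
        ∫ t, res z t * f t ∂μ := by
      rw [L2.inner_def]
      refine integral_congr_ae ?_
      filter_upwards [(hμ.memLp hf.continuous hc).coeFn_toLp,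
        (memLp_res (conj_im_ne_zero hz) hμ).coeFn_toLp] with t h2 h3
      rw [resLp, h3, h2, RCLike.inner_apply, conj_res, Complex.conj_conj, mul_comm]
    rw [ContinuousLinearMap.comp_apply, h1, add_apply, smul_apply,
      InnerProductSpace.rankOne_apply, h5, ContinuousLinearMap.comp_apply, smul_smul]
    filter_upwards [hV _ hF hFc, hV _ hf hc,
      mulOp_coeFn (memLp_top_res hz ν) (V ((hμ.memLp hf.continuous hc).toLp f)),
      Lp.coeFn_add (mulOp (memLp_top_res hz ν) (V ((hμ.memLp hf.continuous hc).toLp f)))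
        (((α : ℂ) * ∫ t, res z t * f t ∂μ) • (memLp_res_right hV hz).toLp (res z)),
      Lp.coeFn_smul ((α : ℂ) * ∫ t, res z t * f t ∂μ) ((memLp_res_right hV hz).toLp (res z)),
      (memLp_res_right hV hz).coeFn_toLp] with s h6 h7 h8 h9 h10 h11
    rw [h6, h9, Pi.add_apply, h8, h7, h10, Pi.smul_apply, h11, reprV_res_mul hμ α hz hf hc,
      smul_eq_mul]
    ring
  have h := DFunLike.congr_fun key g
  rwa [ContinuousLinearMap.comp_apply, add_apply, ContinuousLinearMap.comp_apply, smul_apply,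
    InnerProductSpace.rankOne_apply, smul_smul] at h

/-! ### The Krein resolvent and its intertwining with V -/

/-- The resolvent `(A_α - z)⁻¹`, by the Krein formula. -/
def pertResolvent {μ : Measure ℝ} (hμ : FormBounded μ) (α : ℝ) {z : ℂ} (hz : z.im ≠ 0) :
    Lp ℂ 2 μ →L[ℂ] Lp ℂ 2 μ :=
  mulOp (memLp_top_res hz μ) - ((α : ℂ) / pertFactor μ α z) •
    InnerProductSpace.rankOne ℂ (resLp hμ hz) (resLp hμ (conj_im_ne_zero hz))

theorem pertResolvent_apply {μ : Measure ℝ} (hμ : FormBounded μ) (α : ℝ) {z : ℂ} (hz : z.im ≠ 0)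
    (g : Lp ℂ 2 μ) :
    pertResolvent hμ α hz g = mulOp (memLp_top_res hz μ) g -
      ((α : ℂ) / pertFactor μ α z * inner ℂ (resLp hμ (conj_im_ne_zero hz)) g) •
        resLp hμ hz := by
  simp [pertResolvent, smul_smul]

theorem adjoint_pertResolvent {μ : Measure ℝ} (hμ : FormBounded μ) (α : ℝ) {z : ℂ}
    (hz : z.im ≠ 0) :
    ContinuousLinearMap.adjoint (pertResolvent hμ α hz) =
      pertResolvent hμ α (conj_im_ne_zero hz) := by
  have h1 : mulOp (memLp_top_conj (memLp_top_res hz μ)) =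
      mulOp (memLp_top_res (conj_im_ne_zero hz) μ) :=
    mulOp_congr _ _ (Eventually.of_forall fun t => conj_res z t)
  have h2 : resLp hμ (conj_im_ne_zero (conj_im_ne_zero hz)) = resLp hμ hz := by
    simp only [resLp, Complex.conj_conj]
  rw [pertResolvent, pertResolvent, map_sub, adjoint_mulOp, h1, map_smulₛₗ,
    InnerProductSpace.adjoint_rankOne, h2, map_div₀, conj_pertFactor, Complex.conj_ofReal]

/-- The image of the Krein correction carries the factor F(z), which cancels its denominator; what
remains is exactly the rank one defect of `map_mulOp_res`. -/
theorem map_pertResolvent {μ ν : Measure ℝ} {hμ : FormBounded μ} {α : ℝ}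
    {V : Lp ℂ 2 μ →L[ℂ] Lp ℂ 2 ν} (hV : ExtendsReprV μ ν hμ α V) {z : ℂ} (hz : z.im ≠ 0)
    (g : Lp ℂ 2 μ) :
    V (pertResolvent hμ α hz g) = mulOp (memLp_top_res hz ν) (V g) := by
  have h1 : V (resLp hμ hz) = pertFactor μ α z • (memLp_res_right hV hz).toLp (res z) := by
    refine Lp.ext ?_
    filter_upwards [map_resLp hV hz, Lp.coeFn_smul (pertFactor μ α z)
      ((memLp_res_right hV hz).toLp (res z)), (memLp_res_right hV hz).coeFn_toLp] with s h2 h3 h4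
    rw [h2, h3, Pi.smul_apply, h4, smul_eq_mul]
  have h0 := pertFactor_ne_zero hμ α hz
  rw [pertResolvent_apply, map_sub, map_smul, h1, map_mulOp_res hV hz, smul_smul,
    mul_right_comm, div_mul_cancel₀ _ h0, add_sub_cancel_right]

/-! ### Symbols of positive operators, and the polar decomposition -/

theorem memLp_top_ofReal {ρ : Measure ℝ} {ψ : ℝ → ℝ} {C : ℝ} (hm : Measurable ψ)
    (h0 : ∀ t, 0 ≤ ψ t) (hC : ∀ t, ψ t ≤ C) : MemLp (fun t => (ψ t : ℂ)) ⊤ ρ := by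
  refine memLp_top_of_bound (Complex.measurable_ofReal.comp hm).aestronglyMeasurable C
    (Eventually.of_forall fun t => ?_)
  rw [Complex.norm_real, Real.norm_of_nonneg (h0 t)]
  exact hC t

theorem memLp_top_indicator_one (ρ : Measure ℝ) {E : Set ℝ} (hE : MeasurableSet E) :
    MemLp (E.indicator fun _ => (1 : ℂ)) ⊤ ρ :=
  (memLp_top_const 1).indicator hE

/-- A positive operator on `L²(ρ)` whose commutant contains a point separating algebra of
multiplication operators is multiplication by a bounded nonnegative function. -/
theorem exists_symbol {ρ : Measure ℝ} {T : Lp ℂ 2 ρ →L[ℂ] Lp ℂ 2 ρ} (hT : T.IsPositive)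
    (hA : ((commutantAlgebra T hT.isSelfAdjoint).map
      (BoundedContinuousFunction.toContinuousMapStarₐ ℂ)).SeparatesPoints)
    {e : Lp ℂ 2 ρ} (he : ∀ᵐ t ∂ρ, e t ≠ 0) :
    ∃ ψ : ℝ → ℝ, Measurable ψ ∧ (∀ t, 0 ≤ ψ t) ∧ (∀ t, ψ t ≤ ‖T‖) ∧
      ∀ x : Lp ℂ 2 ρ, T x =ᵐ[ρ] fun t => (ψ t : ℂ) * x t := by
  have hi : Integrable (fun t => e t * conj (T e t)) ρ := by
    simpa only [RCLike.inner_apply] using L2.integrable_inner (𝕜 := ℂ) (T e) e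
  have hie : Integrable (fun t => ‖T‖ * ‖e t‖ ^ 2) ρ :=
    ((memLp_two_iff_integrable_sq_norm (Lp.memLp e).1).1 (Lp.memLp e)).const_mul _
  have hreal : ∀ᵐ t ∂ρ, e t * conj (T e t) = ((e t * conj (T e t)).re : ℂ) := by
    filter_upwards [apply_mul_conj_ae_eq hT.isSelfAdjoint hA e e] with t ht
    refine (Complex.conj_eq_iff_re.1 ?_).symm
    rw [map_mul, Complex.conj_conj, mul_comm, ht]
  have hset : ∀ E : Set ℝ, MeasurableSet E →
      0 ≤ ∫ t in E, (e t * conj (T e t)).re ∂ρ ∧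
        ∫ t in E, (e t * conj (T e t)).re ∂ρ ≤ ∫ t in E, ‖T‖ * ‖e t‖ ^ 2 ∂ρ := by
    intro E hE
    -- Testing T on the restriction of e to E turns 0 ≤ ⟨x, Tx⟩ ≤ ‖T‖ ‖x‖² into bounds on integrals
    -- over E, hence pointwise a.e. bounds.
    set x := mulOp (memLp_top_indicator_one ρ hE) e with hx
    have hx1 : x =ᵐ[ρ] E.indicator e := by
      filter_upwards [mulOp_coeFn (memLp_top_indicator_one ρ hE) e] with t ht
      rw [hx, ht]
      by_cases h : t ∈ E <;> simp [h]
    have h1 : inner ℂ x (T x) = ∫ t in E, e t * conj (T e t) ∂ρ := by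
      rw [L2.inner_def, ← integral_indicator hE]
      refine integral_congr_ae ?_
      filter_upwards [hx1, apply_mul_conj_ae_eq hT.isSelfAdjoint hA x e] with t h2 h3
      rw [RCLike.inner_apply]
      by_cases h : t ∈ E
      · rw [h2, Set.indicator_of_mem h, Set.indicator_of_mem h, h3, h2, Set.indicator_of_mem h]
      · rw [h2, Set.indicator_of_notMem h, Set.indicator_of_notMem h, map_zero, mul_zero]
    have h4 : ∫ t in E, (e t * conj (T e t)).re ∂ρ = (inner ℂ x (T x)).re := by
      rw [h1]
      exact integral_re hi.restrict
    have h5 : ‖x‖ ^ 2 = ∫ t in E, ‖e t‖ ^ 2 ∂ρ := by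
      rw [norm_sq_eq_integral, ← integral_indicator hE]
      refine integral_congr_ae ?_
      filter_upwards [hx1] with t h2
      by_cases h : t ∈ E <;> simp [h2, h]
    rw [h4, integral_const_mul, ← h5]
    refine ⟨hT.re_inner_nonneg_right x, ?_⟩
    calc (inner ℂ x (T x)).re ≤ ‖x‖ * ‖T x‖ := re_inner_le_norm (𝕜 := ℂ) x (T x)
      _ ≤ ‖x‖ * (‖T‖ * ‖x‖) := by gcongr; exact T.le_opNorm x
      _ = ‖T‖ * ‖x‖ ^ 2 := by ring
  have hnonneg : ∀ᵐ t ∂ρ, 0 ≤ (e t * conj (T e t)).re :=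
    ae_nonneg_of_forall_setIntegral_nonneg hi.re fun E hE _ => (hset E hE).1
  have hle : ∀ᵐ t ∂ρ, (e t * conj (T e t)).re ≤ ‖T‖ * ‖e t‖ ^ 2 := by
    have h1 := ae_nonneg_of_forall_setIntegral_nonneg (hie.sub hi.re) fun E hE _ => by
      change 0 ≤ ∫ t in E, (‖T‖ * ‖e t‖ ^ 2 - (e t * conj (T e t)).re) ∂ρ
      rw [integral_sub hie.restrict (show Integrable (fun t => (e t * conj (T e t)).re) _
        from hi.re.restrict)]
      exact sub_nonneg.2 (hset E hE).2
    filter_upwards [h1] with t ht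
    exact sub_nonneg.1 ht
  have hme : Measurable e := (Lp.stronglyMeasurable e).measurable
  have hmT : Measurable (T e) := (Lp.stronglyMeasurable (T e)).measurable
  -- The symbol is the quotient Te/e. Truncation to [0, ‖T‖] makes the bounds hold everywhere and
  -- alters it only on a null set.
  refine ⟨fun t => min (max ((e t * conj (T e t)).re / ‖e t‖ ^ 2) 0) ‖T‖, ?_, fun t => ?_,
    fun t => min_le_right _ _, fun x => ?_⟩
  · have h1 : Measurable fun t => conj (T e t) := Complex.continuous_conj.measurable.comp hmT
    exact (((Complex.measurable_re.comp (hme.mul h1)).div (hme.norm.pow_const 2)).max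
      measurable_const).min measurable_const
  · exact le_min (le_max_right _ _) (norm_nonneg T)
  · filter_upwards [he, hreal, hnonneg, hle, apply_mul_conj_ae_eq hT.isSelfAdjoint hA x e]
      with t h1 h2 h3 h4 h5
    have h6 : 0 < ‖e t‖ ^ 2 := by positivity
    have h7 : conj (e t) ≠ 0 := by simpa using h1
    rw [max_eq_left (by positivity), min_eq_left (by rwa [div_le_iff₀ h6]), Complex.ofReal_div,
      ← h2]
    -- Multiplied by the conjugate of e, the claim becomes the symmetry relation between x and e.
    refine mul_right_cancel₀ h7 ?_
    rw [h5, Complex.ofReal_pow, ← Complex.mul_conj']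
    field_simp

/-- If `S` is self-adjoint and injective with `S² = V V*` and `V` is injective, then `V = S U` with
`U` unitary. -/
theorem exists_unitary_factor {H K : Type*} [NormedAddCommGroup H] [InnerProductSpace ℂ H]
    [CompleteSpace H] [NormedAddCommGroup K] [InnerProductSpace ℂ K] [CompleteSpace K]
    (V : H →L[ℂ] K) (S : K →L[ℂ] K) (hV : V.ker = ⊥) (hS : S.ker = ⊥)
    (hSa : IsSelfAdjoint S) (hSV : S * S = V ∘L ContinuousLinearMap.adjoint V) :
    ∃ U : H ≃ₗᵢ[ℂ] K, ∀ f, S (U f) = V f := by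
  have hadj : ContinuousLinearMap.adjoint S = S := hSa.star_eq
  have hSV' : ∀ g, S (S g) = V (ContinuousLinearMap.adjoint V g) := fun g =>
    DFunLike.congr_fun hSV g
  have hd1 : DenseRange (ContinuousLinearMap.adjoint V) := by
    have h1 := (ContinuousLinearMap.adjoint V).orthogonal_range
    rw [ContinuousLinearMap.adjoint_adjoint, hV] at h1
    exact Submodule.dense_iff_topologicalClosure_eq_top.2
      ((Submodule.topologicalClosure_eq_top_iff).2 h1)
  have hd2 : DenseRange S := by
    have h1 := S.orthogonal_range
    rw [hadj, hS] at h1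
    exact Submodule.dense_iff_topologicalClosure_eq_top.2
      ((Submodule.topologicalClosure_eq_top_iff).2 h1)
  -- ‖Sg‖² = ⟨S²g, g⟩ = ⟨VV*g, g⟩ = ‖V*g‖², so V*g ↦ Sg is isometric between dense ranges and
  -- extends to a unitary.
  have hn : ∀ g, ‖S g‖ = ‖ContinuousLinearMap.adjoint V g‖ := by
    intro g
    have h1 : inner ℂ (S g) (S g) = inner ℂ (ContinuousLinearMap.adjoint V g)
        (ContinuousLinearMap.adjoint V g) := by
      rw [ContinuousLinearMap.adjoint_inner_right, ← hSV',
        ← ContinuousLinearMap.adjoint_inner_left, hadj]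
    rw [inner_self_eq_norm_sq_to_K, inner_self_eq_norm_sq_to_K] at h1
    have h2 : ‖S g‖ ^ 2 = ‖ContinuousLinearMap.adjoint V g‖ ^ 2 := by exact_mod_cast h1
    exact (sq_eq_sq₀ (norm_nonneg _) (norm_nonneg _)).1 h2
  let U := (LinearEquiv.refl ℂ K).extendOfIsometry
    (ContinuousLinearMap.adjoint V).toLinearMap S.toLinearMap hd1 hd2 hn
  have hU : ∀ g, U (ContinuousLinearMap.adjoint V g) = S g := fun g =>
    LinearEquiv.extendOfIsometry_eq (LinearEquiv.refl ℂ K)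
      (ContinuousLinearMap.adjoint V).toLinearMap S.toLinearMap hd1 hd2 hn g
  refine ⟨U, fun f => ?_⟩
  refine congrFun (hd1.equalizer (S.continuous.comp U.continuous) V.continuous ?_) f
  funext g
  simp only [Function.comp_apply, hU, hSV']

/-! ### VV* as multiplication by a positive function -/

theorem separatesPoints_of_res_mem {A : StarSubalgebra ℂ (BoundedContinuousFunction ℝ ℂ)} {z : ℂ}
    {φ : BoundedContinuousFunction ℝ ℂ} (hφ : φ ∈ A) (h : ∀ t, φ t = res z t) :
    (A.map (BoundedContinuousFunction.toContinuousMapStarₐ ℂ)).SeparatesPoints := by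
  intro s t hst
  refine ⟨φ, ⟨BoundedContinuousFunction.toContinuousMapStarₐ ℂ φ, ⟨φ, hφ, rfl⟩, rfl⟩, ?_⟩
  rw [h, h, res, res]
  intro h1
  rw [inv_inj, sub_left_inj, Complex.ofReal_inj] at h1
  exact hst h1

/-- With R the resolvent at z and M multiplication by `res z`, VR = MV. The same relation at the
conjugate point reads VR* = M*V, so RV* = V*M. Hence VV*M = VRV* = MVV*. -/
theorem commute_mulOp_res {μ ν : Measure ℝ} {hμ : FormBounded μ} {α : ℝ}
    {V : Lp ℂ 2 μ →L[ℂ] Lp ℂ 2 ν} (hV : ExtendsReprV μ ν hμ α V) {z : ℂ} (hz : z.im ≠ 0) :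
    Commute (V ∘L ContinuousLinearMap.adjoint V) (mulOp (memLp_top_res hz ν)) := by
  have h1 : V ∘L pertResolvent hμ α hz = mulOp (memLp_top_res hz ν) ∘L V :=
    ContinuousLinearMap.ext fun g => map_pertResolvent hV hz g
  have h2 : V ∘L ContinuousLinearMap.adjoint (pertResolvent hμ α hz) =
      ContinuousLinearMap.adjoint (mulOp (memLp_top_res hz ν)) ∘L V := by
    rw [adjoint_pertResolvent, adjoint_mulOp, mulOp_congr _
      (memLp_top_res (conj_im_ne_zero hz) ν) (Eventually.of_forall fun t => conj_res z t)]
    exact ContinuousLinearMap.ext fun g => map_pertResolvent hV (conj_im_ne_zero hz) g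
  have h3 := congrArg ContinuousLinearMap.adjoint h2
  rw [ContinuousLinearMap.adjoint_comp, ContinuousLinearMap.adjoint_comp,
    ContinuousLinearMap.adjoint_adjoint, ContinuousLinearMap.adjoint_adjoint] at h3
  rw [commute_iff_eq, ContinuousLinearMap.mul_def, ContinuousLinearMap.mul_def,
    ContinuousLinearMap.comp_assoc, ← h3, ← ContinuousLinearMap.comp_assoc, h1,
    ContinuousLinearMap.comp_assoc]

/-- `V V*` is multiplication by a bounded function which is positive almost everywhere. -/
theorem exists_pos_symbol {μ ν : Measure ℝ} {hμ : FormBounded μ} {α : ℝ}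
    {V : Lp ℂ 2 μ →L[ℂ] Lp ℂ 2 ν} (hV : ExtendsReprV μ ν hμ α V) :
    ∃ (ψ : ℝ → ℝ) (C : ℝ), Measurable ψ ∧ (∀ t, 0 ≤ ψ t) ∧ (∀ t, ψ t ≤ C) ∧
      (∀ᵐ t ∂ν, 0 < ψ t) ∧
      ∀ x : Lp ℂ 2 ν, V (ContinuousLinearMap.adjoint V x) =ᵐ[ν] fun t => (ψ t : ℂ) * x t := by
  have hI : Complex.I.im ≠ 0 := by simp
  set T := V ∘L ContinuousLinearMap.adjoint V with hTdef
  have hT : T.IsPositive := ContinuousLinearMap.isPositive_self_comp_adjoint V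
  obtain ⟨K, hK⟩ := exists_norm_res_le_const hI
  let φ : BoundedContinuousFunction ℝ ℂ :=
    BoundedContinuousFunction.ofNormedAddCommGroup (res Complex.I) (continuous_res hI) K hK
  have hφ : φ ∈ commutantAlgebra T hT.isSelfAdjoint := by
    change Commute T (mulOp (memLp_top_bcf ν φ))
    rw [mulOp_congr (memLp_top_bcf ν φ) (memLp_top_res hI ν) (Eventually.of_forall fun t => rfl)]
    exact commute_mulOp_res hV hI
  have he := (memLp_res_right hV hI).coeFn_toLp
  obtain ⟨ψ, hm, h0, hC, hψ⟩ := exists_symbol hT (separatesPoints_of_res_mem hφ fun t => rfl)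
    (e := (memLp_res_right hV hI).toLp _)
    (by filter_upwards [he] with t ht; rw [ht]; exact res_ne_zero hI t)
  refine ⟨ψ, ‖T‖, hm, h0, hC, ?_, hψ⟩
  have hE : MeasurableSet {t | ψ t = 0} := hm (measurableSet_singleton 0)
  -- The Cauchy kernel restricted to {ψ = 0}: since VV*x = 0, also V*x = 0, and x is orthogonal to
  -- the range of V.
  set x := mulOp (memLp_top_indicator_one ν hE) ((memLp_res_right hV hI).toLp _) with hx
  have hx1 := mulOp_coeFn (memLp_top_indicator_one ν hE) ((memLp_res_right hV hI).toLp _)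
  have hTx : T x = 0 := by
    refine Lp.ext ?_
    filter_upwards [hψ x, hx1, Lp.coeFn_zero ℂ 2 ν] with t h1 h2 h3
    rw [h1, h3, h2]
    by_cases h : ψ t = 0 <;> simp [h]
  have hVx : ContinuousLinearMap.adjoint V x = 0 := by
    have h1 : inner ℂ (ContinuousLinearMap.adjoint V x) (ContinuousLinearMap.adjoint V x) =
        (0 : ℂ) := by
      rw [ContinuousLinearMap.adjoint_inner_right]
      change inner ℂ (T x) x = (0 : ℂ)
      rw [hTx, inner_zero_left]
    exact inner_self_eq_zero.1 h1
  have h2 : inner ℂ x (V (resLp hμ hI)) = (0 : ℂ) := by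
    rw [← ContinuousLinearMap.adjoint_inner_left, hVx, inner_zero_left]
  -- V maps the kernel to F(i) times itself, and the kernel agrees with x wherever x is nonzero, so
  -- orthogonality forces F(i)‖x‖² = 0.
  have h3 : (‖x‖ : ℂ) ^ 2 * pertFactor μ α Complex.I = 0 := by
    rw [← h2, ← Complex.coe_algebraMap, ← inner_self_eq_norm_sq_to_K (𝕜 := ℂ) x, L2.inner_def,
      L2.inner_def, ← integral_mul_const]
    refine integral_congr_ae ?_
    filter_upwards [hx1, map_resLp hV hI, he] with t h4 h5 h6
    rw [h5, RCLike.inner_apply, RCLike.inner_apply, h4, h6]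
    by_cases h : ψ t = 0 <;> simp [h]
    ring
  have h4 : x = 0 := by
    rcases mul_eq_zero.1 h3 with h | h
    · simpa using h
    · exact absurd h (pertFactor_ne_zero hμ α hI)
  filter_upwards [hx1, he, (Lp.eq_zero_iff_ae_eq_zero).1 h4] with t h5 h6 h7
  refine (h0 t).lt_of_ne' fun h => ?_
  rw [h5, h6] at h7
  exact res_ne_zero hI t (by simpa [h] using h7)

/-! ### Operators and their domains recovered from resolvents -/

theorem mem_mulVar_domain_iff {ν : Measure ℝ} {z : ℂ} (hz : z.im ≠ 0) {g : Lp ℂ 2 ν} :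
    g ∈ (mulVar ν).domain ↔ ∃ u, g = mulOp (memLp_top_res hz ν) u := by
  constructor
  · intro hg
    have hg' : MemLp (fun s : ℝ => (s : ℂ) * g s) 2 ν := hg
    have h1 : MemLp (fun s : ℝ => (s : ℂ) * g s - z * g s) 2 ν :=
      hg'.sub ((Lp.memLp g).const_mul z)
    -- The preimage is u = (s - z)g.
    refine ⟨h1.toLp _, Lp.ext ?_⟩
    filter_upwards [mulOp_coeFn (memLp_top_res hz ν) (h1.toLp _), h1.coeFn_toLp] with s h2 h3
    rw [h2, h3, ← sub_mul, ← mul_assoc, mul_comm (res z s), sub_mul_res hz, one_mul]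
  · rintro ⟨u, rfl⟩
    have h1 : MemLp (fun s : ℝ => u s + z * mulOp (memLp_top_res hz ν) u s) 2 ν :=
      (Lp.memLp u).add ((Lp.memLp _).const_mul z)
    refine h1.ae_eq ?_
    filter_upwards [mulOp_coeFn (memLp_top_res hz ν) u] with s h2
    rw [h2]
    linear_combination (-u s) * sub_mul_res hz s

theorem mulVar_mulOp_res {ν : Measure ℝ} {z : ℂ} (hz : z.im ≠ 0) {u : Lp ℂ 2 ν}
    (g : (mulVar ν).domain) (hg : (g : Lp ℂ 2 ν) = mulOp (memLp_top_res hz ν) u) :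
    mulVar ν g = z • (g : Lp ℂ 2 ν) + u := by
  refine Lp.ext ?_
  filter_upwards [mulOp_coeFn (memLp_top_res hz ν) u, (mem_weightDomain.1 g.2).coeFn_toLp,
    Lp.coeFn_add (z • (g : Lp ℂ 2 ν)) u, Lp.coeFn_smul z (g : Lp ℂ 2 ν)] with s h1 h2 h3 h4
  have h5 : mulVar ν g s = (s : ℂ) * (g : Lp ℂ 2 ν) s := h2
  rw [h5, h3, Pi.add_apply, h4, Pi.smul_apply, smul_eq_mul, hg, h1]
  linear_combination (u s) * sub_mul_res hz s

theorem inner_resLp {μ : Measure ℝ} (hμ : FormBounded μ) {z : ℂ} (hz : z.im ≠ 0)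
    (u : Lp ℂ 2 μ) :
    inner ℂ (resLp hμ (conj_im_ne_zero hz)) u = ∫ t, res z t * u t ∂μ := by
  rw [L2.inner_def]
  refine integral_congr_ae ?_
  filter_upwards [(memLp_res (conj_im_ne_zero hz) hμ).coeFn_toLp] with t h
  rw [resLp, h, RCLike.inner_apply, conj_res, Complex.conj_conj, mul_comm]

theorem pertResolvent_coeFn {μ : Measure ℝ} (hμ : FormBounded μ) (α : ℝ) {z : ℂ} (hz : z.im ≠ 0)
    (u : Lp ℂ 2 μ) :
    pertResolvent hμ α hz u =ᵐ[μ] fun t => res z t * u t -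
      (α : ℂ) / pertFactor μ α z * (∫ x, res z x * u x ∂μ) * res z t := by
  rw [pertResolvent_apply, inner_resLp hμ hz]
  filter_upwards [Lp.coeFn_sub (mulOp (memLp_top_res hz μ) u)
      (((α : ℂ) / pertFactor μ α z * ∫ x, res z x * u x ∂μ) • resLp hμ hz),
    mulOp_coeFn (memLp_top_res hz μ) u,
    Lp.coeFn_smul ((α : ℂ) / pertFactor μ α z * ∫ x, res z x * u x ∂μ) (resLp hμ hz),
    (memLp_res hz hμ).coeFn_toLp] with t h1 h2 h3 h4
  rw [h1, Pi.sub_apply, h2, h3, Pi.smul_apply, resLp, h4, smul_eq_mul]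

theorem integrable_res_mul {μ : Measure ℝ} (hμ : FormBounded μ) {z : ℂ} (hz : z.im ≠ 0)
    (u : Lp ℂ 2 μ) : Integrable (fun t => res z t * u t) μ :=
  (memLp_res hz hμ).integrable_mul (Lp.memLp u)

/-- Makes the constant α ∫ f dμ in A_α f explicit for f in the range of the resolvent, where it
cancels the Krein correction. -/
theorem integral_pertResolvent {μ : Measure ℝ} (hμ : FormBounded μ) (α : ℝ) {z : ℂ} (hz : z.im ≠ 0)
    (u : Lp ℂ 2 μ) :
    ∫ t, pertResolvent hμ α hz u t ∂μ = (∫ t, res z t * u t ∂μ) / pertFactor μ α z := by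
  have h0 := pertFactor_ne_zero hμ α hz
  rw [integral_congr_ae (pertResolvent_coeFn hμ α hz u),
    integral_sub (integrable_res_mul hμ hz u) ((integrable_res hz hμ).const_mul _),
    integral_const_mul]
  have h1 : (α : ℂ) * ∫ t, res z t ∂μ = pertFactor μ α z - 1 := by
    rw [pertFactor]
    ring
  field_simp
  linear_combination -(∫ t, res z t * u t ∂μ) * h1

theorem pertFun_pertResolvent {μ : Measure ℝ} (hμ : FormBounded μ) (α : ℝ) {z : ℂ} (hz : z.im ≠ 0)
    (u : Lp ℂ 2 μ) :
    pertFun μ α (pertResolvent hμ α hz u) =ᵐ[μ]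
      (z • pertResolvent hμ α hz u + u : Lp ℂ 2 μ) := by
  filter_upwards [pertResolvent_coeFn hμ α hz u, Lp.coeFn_add (z • pertResolvent hμ α hz u) u,
    Lp.coeFn_smul z (pertResolvent hμ α hz u)] with t h1 h2 h3
  rw [h2, Pi.add_apply, h3, Pi.smul_apply, smul_eq_mul, pertFun, integral_pertResolvent, h1]
  linear_combination (u t - (α : ℂ) / pertFactor μ α z * ∫ x, res z x * u x ∂μ) *
    sub_mul_res hz t

theorem mem_formDomain_pertResolvent {μ : Measure ℝ} (hμ : FormBounded μ) (α : ℝ) {z : ℂ} (hz : z.im ≠ 0)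
    (u : Lp ℂ 2 μ) :
    pertResolvent hμ α hz u ∈ formDomain μ := by
  have h1 : MemLp (fun t => ((√(1 + |t|) : ℂ) * res z t) * u t) 2 μ :=
    (Lp.memLp u).mul (memLp_top_sqrt_mul_res hz μ)
  refine (h1.sub ((memLp_sqrt_mul_res hz hμ).const_mul
    ((α : ℂ) / pertFactor μ α z * ∫ x, res z x * u x ∂μ))).ae_eq ?_
  filter_upwards [pertResolvent_coeFn hμ α hz u] with t h2
  rw [h2, Pi.sub_apply]
  ring

theorem mem_rankOnePert_domain_iff {μ : Measure ℝ} (hμ : FormBounded μ) (α : ℝ) {z : ℂ} (hz : z.im ≠ 0)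
    {f : Lp ℂ 2 μ} :
    f ∈ (rankOnePert μ hμ α).domain ↔ ∃ u, f = pertResolvent hμ α hz u := by
  constructor
  · rintro ⟨hf1, hf2⟩
    have h1 : MemLp (fun t => pertFun μ α f t - z * f t) 2 μ :=
      hf2.sub ((Lp.memLp f).const_mul z)
    have h0 := pertFactor_ne_zero hμ α hz
    have h2 : ∀ t, res z t * (pertFun μ α f t - z * f t) =
        f t + (α : ℂ) * (∫ x, f x ∂μ) * res z t := by
      intro t
      rw [pertFun]
      linear_combination (f t) * sub_mul_res hz t
    -- For u = (A_α - z)f one has `res z` u = f + α (∫ f) `res z`. Integrating recovers F(z) ∫ f,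
    -- the quantity that the Krein formula divides by F(z).
    have h3 : ∫ t, res z t * h1.toLp _ t ∂μ = pertFactor μ α z * ∫ x, f x ∂μ := by
      have h4 : (fun t => res z t * h1.toLp _ t) =ᵐ[μ]
          fun t => f t + (α : ℂ) * (∫ x, f x ∂μ) * res z t := by
        filter_upwards [h1.coeFn_toLp] with t ht
        rw [ht, h2]
      rw [integral_congr_ae h4, integral_add (hμ.integrable hf1)
        ((integrable_res hz hμ).const_mul _), integral_const_mul, pertFactor]
      ring
    refine ⟨h1.toLp _, Lp.ext ?_⟩
    filter_upwards [pertResolvent_coeFn hμ α hz (h1.toLp _), h1.coeFn_toLp] with t h5 h6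
    rw [h5, h6, h3, h2]
    field_simp
    ring
  · rintro ⟨u, rfl⟩
    exact ⟨mem_formDomain_pertResolvent hμ α hz u,
      (Lp.memLp _).ae_eq (pertFun_pertResolvent hμ α hz u).symm⟩

theorem rankOnePert_pertResolvent {μ : Measure ℝ} (hμ : FormBounded μ) (α : ℝ) {z : ℂ} (hz : z.im ≠ 0)
    {u : Lp ℂ 2 μ} (f : (rankOnePert μ hμ α).domain)
    (hf : (f : Lp ℂ 2 μ) = pertResolvent hμ α hz u) :
    rankOnePert μ hμ α f = z • (f : Lp ℂ 2 μ) + u := by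
  refine Lp.ext ?_
  have h1 : rankOnePert μ hμ α f =ᵐ[μ] pertFun μ α (f : Lp ℂ 2 μ) := f.2.2.coeFn_toLp
  refine h1.trans ?_
  rw [hf]
  exact pertFun_pertResolvent hμ α hz u

/-- A unitary operator intertwining the resolvents intertwines the operators. -/
theorem intertwines_of_resolvent {μ ν : Measure ℝ} (hμ : FormBounded μ) (α : ℝ) {z : ℂ}
    (hz : z.im ≠ 0) (U : Lp ℂ 2 μ ≃ₗᵢ[ℂ] Lp ℂ 2 ν)
    (h : ∀ u, U (pertResolvent hμ α hz u) = mulOp (memLp_top_res hz ν) (U u)) :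
    Intertwines U (rankOnePert μ hμ α) (mulVar ν) := by
  constructor
  · intro f
    rw [mem_rankOnePert_domain_iff hμ α hz, mem_mulVar_domain_iff hz]
    constructor
    · rintro ⟨u, rfl⟩
      exact ⟨U u, h u⟩
    · rintro ⟨v, hv⟩
      refine ⟨U.symm v, U.injective ?_⟩
      rw [h, hv, U.apply_symm_apply]
  · intro f g hfg
    obtain ⟨u, hu⟩ := (mem_rankOnePert_domain_iff hμ α hz).1 f.2
    rw [rankOnePert_pertResolvent hμ α hz f hu, mulVar_mulOp_res hz g (u := U u), map_add,
      map_smul, hfg]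
    rw [← hfg, hu, h]

/-! ### Passage to the weighted space -/

/-- If `U f = h V f` defines a unitary operator onto `L²(ν)`, then `V` is unitary onto
`L²(|h|² ν)`. -/
theorem exists_unitary_withDensity {H : Type*} [NormedAddCommGroup H] [InnerProductSpace ℂ H]
    {ν : Measure ℝ} {h : ℝ → ℂ} (hm : Measurable h) (h0 : ∀ s, h s ≠ 0)
    (V : H →L[ℂ] Lp ℂ 2 ν) (U : H ≃ₗᵢ[ℂ] Lp ℂ 2 ν)
    (hU : ∀ f, U f =ᵐ[ν] fun s => h s * V f s) :
    ∃ W : H ≃ₗᵢ[ℂ] Lp ℂ 2 (ν.withDensity fun s => ‖h s‖ₑ ^ 2),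
      ∀ f, W f =ᵐ[ν.withDensity fun s => ‖h s‖ₑ ^ 2] V f := by
  set κ := ν.withDensity fun s => ‖h s‖ₑ ^ 2 with hκ
  have hme : Measurable fun s => ‖h s‖ₑ ^ 2 := hm.enorm.pow_const 2
  have hac : κ ≪ ν := withDensity_absolutelyContinuous _ _
  -- A nowhere vanishing h gives the two measures the same null sets, so a.e. statements transfer
  -- both ways.
  have hac' : ν ≪ κ := withDensity_absolutelyContinuous' hme.aemeasurable
    (Eventually.of_forall fun s => by simpa using h0 s)
  have hnorm : ∀ g : ℝ → ℂ, AEStronglyMeasurable g ν →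
      eLpNorm g 2 κ = eLpNorm (fun s => h s * g s) 2 ν := by
    intro g hg
    rw [eLpNorm_eq_lintegral_rpow_enorm_toReal (by simp) (by simp),
      eLpNorm_eq_lintegral_rpow_enorm_toReal (by simp) (by simp), hκ,
      lintegral_withDensity_eq_lintegral_mul₀ hme.aemeasurable
        (by exact hg.enorm.pow_const _)]
    simp [enorm_mul, mul_pow]
  have hmem : ∀ f, MemLp (V f) 2 κ := by
    intro f
    refine ⟨(Lp.aestronglyMeasurable (V f)).mono_ac hac, ?_⟩
    rw [hnorm _ (Lp.aestronglyMeasurable (V f)), ← eLpNorm_congr_ae (hU f)]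
    exact (Lp.memLp (U f)).2
  let W₀ : H →ₗ[ℂ] Lp ℂ 2 κ :=
    { toFun := fun f => (hmem f).toLp (V f)
      map_add' := fun f g => by
        rw [← MemLp.toLp_add, MemLp.toLp_eq_toLp_iff, map_add]
        exact hac.ae_eq (Lp.coeFn_add _ _)
      map_smul' := fun c f => by
        rw [RingHom.id_apply, ← MemLp.toLp_const_smul, MemLp.toLp_eq_toLp_iff, map_smul]
        exact hac.ae_eq (Lp.coeFn_smul _ _) }
  let W₁ : H →ₗᵢ[ℂ] Lp ℂ 2 κ :=
    { W₀ with
      norm_map' := fun f => by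
        change ‖(hmem f).toLp (V f)‖ = ‖f‖
        rw [Lp.norm_toLp, hnorm _ (Lp.aestronglyMeasurable (V f)), ← eLpNorm_congr_ae (hU f),
          ← Lp.norm_def, U.norm_map] }
  have hsurj : Function.Surjective W₁ := by
    intro g
    have hg : AEStronglyMeasurable g ν := (Lp.aestronglyMeasurable g).mono_ac hac'
    have hg2 : MemLp (fun s => h s * g s) 2 ν := by
      refine ⟨hm.aestronglyMeasurable.mul hg, ?_⟩
      rw [← hnorm _ hg]
      exact (Lp.memLp g).2
    refine ⟨U.symm (hg2.toLp _), Lp.ext ?_⟩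
    have h1 : W₁ (U.symm (hg2.toLp _)) =ᵐ[κ] V (U.symm (hg2.toLp _)) := (hmem _).coeFn_toLp
    refine h1.trans (hac.ae_eq ?_)
    have h2 := hU (U.symm (hg2.toLp _))
    rw [U.apply_symm_apply] at h2
    filter_upwards [h2, hg2.coeFn_toLp] with s h3 h4
    rw [h4] at h3
    exact (mul_left_cancel₀ (h0 s) h3).symm
  exact ⟨LinearIsometryEquiv.ofSurjective W₁ hsurj, fun f => (hmem f).coeFn_toLp⟩

end RankOneRigidity

end

/-! ### The rigidity theorem -/

open RankOneRigidity
theorem theorem2p2 (μ ν : Measure ℝ) (α : ℝ)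
    (hsupp : μ.support.Nontrivial) (hμ : FormBounded μ)
    (V : Lp ℂ 2 μ →L[ℂ] Lp ℂ 2 ν) (hV : ExtendsReprV μ ν hμ α V)
    (hker : LinearMap.ker (V : Lp ℂ 2 μ →ₗ[ℂ] Lp ℂ 2 ν) = ⊥) :
    ∃ h : ℝ → ℂ, Measurable h ∧ (∀ᵐ s ∂ν, h s ≠ 0) ∧
      MemLp (fun s => 1 / h s) ⊤ ν ∧
      (∃ U : Lp ℂ 2 μ ≃ₗᵢ[ℂ] Lp ℂ 2 ν,
        (∀ f : Lp ℂ 2 μ, U f =ᵐ[ν] fun s => h s * V f s) ∧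
        Intertwines U (rankOnePert μ hμ α) (mulVar ν)) ∧
      (∃ W : Lp ℂ 2 μ ≃ₗᵢ[ℂ] Lp ℂ 2 (ν.withDensity fun s => ‖h s‖ₑ ^ 2),
        ∀ f : Lp ℂ 2 μ, W f =ᵐ[ν.withDensity fun s => ‖h s‖ₑ ^ 2] V f) := by
  have hI : Complex.I.im ≠ 0 := by simp
  obtain ⟨ψ, C, hm, h0, hC, hpos, hψ⟩ := exists_pos_symbol hV
  have hrm : Measurable fun t => √(ψ t) := hm.sqrt
  have hr : MemLp (fun t => (√(ψ t) : ℂ)) ⊤ ν :=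
    memLp_top_ofReal hrm (fun t => Real.sqrt_nonneg _) fun t => Real.sqrt_le_sqrt (hC t)
  have hsq : ∀ t, (√(ψ t) : ℂ) * √(ψ t) = ψ t := fun t => by
    rw [← Complex.ofReal_mul, Real.mul_self_sqrt (h0 t)]
  have hne : ∀ᵐ t ∂ν, (√(ψ t) : ℂ) ≠ 0 := by
    filter_upwards [hpos] with t ht
    rw [Complex.ofReal_ne_zero]
    exact (Real.sqrt_pos.2 ht).ne'
  have hSinj : ∀ x y, mulOp hr x = mulOp hr y → x = y := by
    intro x y hxy
    refine Lp.ext ?_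
    have h1 := mulOp_coeFn hr x
    rw [hxy] at h1
    filter_upwards [h1, mulOp_coeFn hr y, hne] with t h2 h3 h4
    exact mul_left_cancel₀ h4 (h2.symm.trans h3)
  have hSa : IsSelfAdjoint (mulOp hr) := by
    rw [ContinuousLinearMap.isSelfAdjoint_iff', adjoint_mulOp]
    exact mulOp_congr _ _ (Filter.Eventually.of_forall fun t => Complex.conj_ofReal _)
  have hSV : mulOp hr * mulOp hr = V ∘L ContinuousLinearMap.adjoint V := by
    refine ContinuousLinearMap.ext fun x => Lp.ext ?_
    filter_upwards [hψ x, mulOp_coeFn hr (mulOp hr x), mulOp_coeFn hr x] with t h1 h2 h3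
    rw [ContinuousLinearMap.comp_apply, h1, mul_apply_eq_comp, h2, h3, ← mul_assoc, hsq]
  obtain ⟨U, hU⟩ := exists_unitary_factor V (mulOp hr) hker
    ((LinearMap.ker_eq_bot).2 fun x y hxy => hSinj x y hxy) hSa hSV
  have hUV : ∀ f, V f =ᵐ[ν] fun t => (√(ψ t) : ℂ) * U f t := fun f => by
    rw [← hU f]
    exact mulOp_coeFn hr (U f)
  -- The value 1 is a default on the ν-null set where √ψ = 0; it keeps h nonzero everywhere, as
  -- `exists_unitary_withDensity` requires.
  let h : ℝ → ℂ := fun t => if √(ψ t) = 0 then 1 else (√(ψ t) : ℂ)⁻¹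
  have hhm : Measurable h := Measurable.ite (hrm (measurableSet_singleton 0)) measurable_const
    (Complex.measurable_ofReal.comp hrm).inv
  have hh0 : ∀ t, h t ≠ 0 := fun t => by
    by_cases ht : √(ψ t) = 0
    · simp [h, ht]
    · simp only [h, if_neg ht]
      exact inv_ne_zero (by exact_mod_cast ht)
  have hhr : ∀ᵐ t ∂ν, h t = (√(ψ t) : ℂ)⁻¹ := by
    filter_upwards [hne] with t ht
    exact if_neg fun h1 => ht (by rw [h1, Complex.ofReal_zero])
  have hUh : ∀ f, U f =ᵐ[ν] fun s => h s * V f s := fun f => by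
    filter_upwards [hUV f, hne, hhr] with t h1 h2 h3
    rw [h1, h3, inv_mul_cancel_left₀ h2]
  refine ⟨h, hhm, Filter.Eventually.of_forall hh0, ?_, ⟨U, hUh, ?_⟩,
    exists_unitary_withDensity hhm hh0 V U hUh⟩
  · refine hr.ae_eq ?_
    filter_upwards [hhr] with t ht
    rw [ht, one_div, inv_inv]
  · refine intertwines_of_resolvent hμ α hI U fun u => hSinj _ _ ?_
    have hc := DFunLike.congr_fun (mulOp_commute hr (memLp_top_res hI ν)).eq (U u)
    rw [mul_apply_eq_comp, mul_apply_eq_comp, hU] at hc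
    rw [hU, map_pertResolvent hV, hc]
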